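/- Let $F$ be a number field with ring of integers $\mathcal O$ and different $\mathfrak D$. Write $e(t)=e^{2\pi i t}$ and let $\psi=\psi_\infty\prod_{v\nmid\infty}\psi_v$ be the standard additive character of $\mathbb A_F/F$, with $\psi_\infty(x)=e(-\mathrm{Tr}_{F_\infty}(x))$ and with $\psi_v$ of conductor $\mathfrak D_v^{-1}$ for every finite place $v$. For a nonzero integral ideal $\mathfrak b$ put $\psi_{\mathfrak b}=\prod_{\mathfrak p_v\mid\mathfrak b}\psi_v$, viewed as a function on $F$, and $\mathfrak D_{\mathfrak b}=\prod_{\mathfrak p_v\mid\mathfrak b}\mathfrak p_v^{\mathrm{ord}_v(\mathfrak D)}$. Let $\mathrm N$ be the ideal norm and $\mu$ the Möbius function on nonzero integral ideals. For nonzero fractional ideals $\mathfrak q\subseteq\mathfrak b$, let $(\mathfrak b/\mathfrak q)^\times$ be the set of $x\in\mathfrak b/\mathfrak q$ that generate $\mathfrak b/\mathfrak q$ as an $\mathcal O$-module, and for such $x$ let $x^{-1}$ be the unique class $y\in(\mathfrak b^{-1}/\mathfrak q\mathfrak b^{-2})^\times$ with $xy\in 1+\mathfrak q\mathfrak b^{-1}$.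 For integral ideals $\mathfrak q\mid\mathfrak b$ and $\alpha,\beta\in F$ with $\mathrm{ord}_v(\alpha)\ge 0$ and $\mathrm{ord}_v(\beta)\ge-2\,\mathrm{ord}_v(\mathfrak q\mathfrak D)$ for all $\mathfrak p_v\mid\mathfrak b$, define the Kloosterman sum $$\mathrm{Kl}_{\mathfrak b}(\alpha,\beta;\mathfrak q)=\sum_{x\in((\mathfrak q\mathfrak D_{\mathfrak b})^{-1}/\mathfrak D_{\mathfrak b}^{-1})^\times}\psi_{\mathfrak b}(\alpha x+\beta x^{-1}).$$ Let $\mathfrak a,\mathfrak c$ be nonzero fractional ideals and $\mathfrak d,\mathfrak q$ nonzero integral ideals such that $(\mathfrak c\mathfrak D)^2(\mathfrak a\mathfrak d)^{-1}=(\beta_{\mathfrak d})$ and $\mathfrak c^{-1}\mathfrak q=(c_{\mathfrak q})$ are principal, with generators $\beta_{\mathfrak d},c_{\mathfrak q}\in F^\times$. Put $\mathfrak b=(\mathfrak d,\mathfrak q)^{-1}\mathfrak q$, let $\mathfrak q_1\mid\mathfrak b$ be an integral ideal, and let $\gamma\in\mathfrak a(\mathfrak b\mathfrak q_1^2\mathfrak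 D^3)^{-1}$. Define $$T_{\mathfrak d}(\gamma;\mathfrak q,\mathfrak q_1)=\sum_{x\in(\mathfrak a\mathfrak d(\mathfrak c\mathfrak D)^{-1}/\mathfrak a\mathfrak d(\mathfrak c\mathfrak D)^{-1}\mathfrak q)^\times}\psi_\infty\Big(\frac{x^{-1}}{\beta_{\mathfrak d}c_{\mathfrak q}}\Big)\,\mathrm{Kl}_{\mathfrak b}(1,-\gamma c_{\mathfrak q}/x;\mathfrak q_1),$$ where $1/x$ is read as the class $x^{-1}$. Let $\breve{\mathfrak q}_1$ be the square-free part of $\mathfrak q_1$ (the product of the primes dividing $\mathfrak q_1$ exactly once). Then $T_{\mathfrak d}(\gamma;\mathfrak q,\mathfrak q_1)=0$ unless $(\mathfrak q_1,\mathfrak q\mathfrak q_1^{-1})=(1)$, in which case $$T_{\mathfrak d}(\gamma;\mathfrak q,\mathfrak q_1)=\psi_{\mathfrak b}(-\beta_{\mathfrak d}c_{\mathfrak q}^2\gamma)\,\mu(\mathfrak q\mathfrak q_1^{-1})\,\mathrm N(\mathfrak q_1)\sum_{\mathfrak q_2,\,\mathfrak f}\frac{\mu(\mathfrak q_1\mathfrak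 q_2^{-1})\mu(\mathfrak f)}{\mathrm N(\mathfrak f)}\,\psi_{\mathfrak f}(\beta_{\mathfrak d}c_{\mathfrak q}^2\gamma),$$ where the sum is over integral ideals $\mathfrak q_2\mid\mathfrak q_1$ and $\mathfrak f\mid\breve{\mathfrak q}_1$ with $(\mathfrak q_2,\mathfrak q\mathfrak q_1^{-1})=(\mathfrak q_2,\mathfrak f)=(1)$ and $\gamma\in\mathfrak a(\mathfrak b\mathfrak q_1\mathfrak q_2\mathfrak f\mathfrak D^3)^{-1}$. -/

import Mathlib

open NumberField IsDedekindDomain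
open scoped nonZeroDivisors

noncomputable section

namespace VoronoiSum

/-- Fractional ideals of the number field `K`. -/
abbrev FracIdeal (K : Type*) [Field K] [NumberField K] := FractionalIdeal (𝓞 K)⁰ K

/-- The different ideal of `K`, as a fractional ideal. -/
def different (K : Type*) [Field K] [NumberField K] : FracIdeal K :=
  ((differentIdeal ℤ (𝓞 K) : Ideal (𝓞 K)) : FractionalIdeal (𝓞 K)⁰ K)

/-! ### The standard additive character -/

open scoped Classical in
/-- The archimedean part of the standard additive character: the product over the real places of
`e(-x)` and over the complex places of `e(-(z + conj z))`, where `e(t) = exp(2πit)`, on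
`K_∞ = ℝ^{r₁} × ℂ^{r₂}`. -/
def psiInf {K : Type*} [Field K] [NumberField K] (x : mixedEmbedding.mixedSpace K) : ℂ :=
  (∏ w : {w : InfinitePlace K // w.IsReal}, (Real.fourierChar (-(x.1 w)) : ℂ)) *
    ∏ w : {w : InfinitePlace K // w.IsComplex},
      (Real.fourierChar (-(x.2 w + (starRingEnd ℂ) (x.2 w)).re) : ℂ)

/-- `k ∈ K` is a polar part at `v` of `x ∈ K_v` if `x - k` is integral at `v` and `k` is integral
at every other finite place. -/
def IsPolarPart {K : Type*} [Field K] [NumberField K] (v : HeightOneSpectrum (𝓞 K))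
    (x : v.adicCompletion K) (k : K) : Prop :=
  Valued.v (x - algebraMap K (v.adicCompletion K) k) ≤ 1 ∧
    ∀ w : HeightOneSpectrum (𝓞 K), w ≠ v → w.valuation K k ≤ 1

theorem valued_algebraMap {K : Type*} [Field K] [NumberField K] (v : HeightOneSpectrum (𝓞 K))
    (k : K) : Valued.v (algebraMap K (v.adicCompletion K) k) = v.valuation K k :=
  v.valuedAdicCompletion_eq_valuation' k

theorem exists_polar_global {K : Type*} [Field K] [NumberField K] (v : HeightOneSpectrum (𝓞 K))
    (k₀ : K) : ∃ k : K, v.valuation K (k₀ - k) ≤ 1 ∧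
    ∀ w : HeightOneSpectrum (𝓞 K), w ≠ v → w.valuation K k ≤ 1 := by
  obtain ⟨a, s, hs, rfl⟩ := IsFractionRing.div_surjective (𝓞 K) k₀
  have hs0 : s ≠ 0 := nonZeroDivisors.ne_zero hs
  have hsK : algebraMap (𝓞 K) K s ≠ 0 := by simpa using hs0
  have hfin : FiniteMultiplicity v.asIdeal (Ideal.span {s}) :=
    FiniteMultiplicity.of_prime_left v.prime (by simpa using hs0)
  obtain ⟨J, hJ, hvJ⟩ := hfin.exists_eq_pow_mul_and_not_dvd
  set n := multiplicity v.asIdeal (Ideal.span {s})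
  have hcop : IsCoprime (v.asIdeal ^ n) J := by
    apply IsCoprime.pow_left
    rw [Ideal.isCoprime_iff_sup_eq]
    by_contra h
    apply hvJ
    rw [Ideal.dvd_iff_le]
    have := v.isMaximal.eq_of_le h le_sup_left
    rw [this]
    exact le_sup_right
  obtain ⟨t, ht, e, he, hte⟩ := Ideal.isCoprime_iff_exists.1 hcop
  have hsn : WithZero.exp (-(n : ℤ)) ≤ v.intValuation s := by
    rw [v.intValuation_eq_exp_neg_multiplicity hs0]
  refine ⟨algebraMap (𝓞 K) K a / algebraMap (𝓞 K) K s * algebraMap (𝓞 K) K e, ?_, ?_⟩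
  · have h1 : algebraMap (𝓞 K) K a / algebraMap (𝓞 K) K s -
        algebraMap (𝓞 K) K a / algebraMap (𝓞 K) K s * algebraMap (𝓞 K) K e =
        algebraMap (𝓞 K) K a * algebraMap (𝓞 K) K t / algebraMap (𝓞 K) K s := by
      have : algebraMap (𝓞 K) K t = 1 - algebraMap (𝓞 K) K e := by
        rw [← map_one (algebraMap (𝓞 K) K), ← hte, map_add]; ring
      rw [this]; ring
    rw [h1, map_div₀, map_mul, v.valuation_of_algebraMap, v.valuation_of_algebraMap,
      v.valuation_of_algebraMap]
    apply div_le_one_of_le₀ _ (zero_le)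
    calc v.intValuation a * v.intValuation t ≤ 1 * WithZero.exp (-(n : ℤ)) :=
          mul_le_mul' (v.intValuation_le_one a) ((v.intValuation_le_pow_iff_mem t n).2 ht)
      _ ≤ v.intValuation s := by rwa [one_mul]
  · intro w hw
    obtain ⟨p, hp, hpw⟩ : ∃ p ∈ v.asIdeal ^ n, p ∉ w.asIdeal := by
      by_contra! h
      have h2 : v.asIdeal ≤ w.asIdeal := w.isPrime.le_of_pow_le h
      exact hw (HeightOneSpectrum.ext (v.isMaximal.eq_of_le w.isPrime.ne_top h2).symm)
    have hpe : p * e ∈ Ideal.span {s} := by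
      rw [hJ]; exact Ideal.mul_mem_mul hp he
    obtain ⟨r, hr⟩ := Ideal.mem_span_singleton'.1 hpe
    have hval : w.valuation K (algebraMap (𝓞 K) K p) = 1 := by
      rw [HeightOneSpectrum.valuation_eq_one_iff_notMem]; exact hpw
    have hmul : algebraMap (𝓞 K) K a / algebraMap (𝓞 K) K s * algebraMap (𝓞 K) K e *
        algebraMap (𝓞 K) K p = algebraMap (𝓞 K) K (a * r) := by
      have := congrArg (algebraMap (𝓞 K) K) hr
      rw [map_mul, map_mul] at this
      rw [map_mul]
      field_simp
      linear_combination -(algebraMap (𝓞 K) K a) * this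
    have := w.valuation_le_one (K := K) (a * r)
    change w.valuation K (algebraMap (𝓞 K) K (a * r)) ≤ 1 at this
    rwa [← hmul, map_mul, hval, mul_one] at this

theorem exists_isPolarPart {K : Type*} [Field K] [NumberField K] (v : HeightOneSpectrum (𝓞 K))
    (x : v.adicCompletion K) : ∃ k : K, IsPolarPart v x k := by
  have hopen : IsOpen {y : v.adicCompletion K | x - y ∈ v.adicCompletionIntegers K} :=
    (Valued.isOpen_valuationSubring _).preimage (continuous_const.sub continuous_id)
  obtain ⟨k₀, hk₀⟩ := (HeightOneSpectrum.denseRange_algebraMap K v).exists_mem_open hopen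
    ⟨x, by simp⟩
  obtain ⟨k, hk, hk'⟩ := exists_polar_global v k₀
  refine ⟨k, ?_, hk'⟩
  have h : x - algebraMap K (v.adicCompletion K) k =
      (x - algebraMap K (v.adicCompletion K) k₀) +
        algebraMap K (v.adicCompletion K) (k₀ - k) := by
    rw [map_sub]; ring
  rw [h]
  refine (Valued.v.map_add _ _).trans (max_le ?_ ?_)
  · exact hk₀
  · rwa [valued_algebraMap]

theorem fourierChar_trace_eq_one {K : Type*} [Field K] [NumberField K] (k : K)
    (h : ∀ w : HeightOneSpectrum (𝓞 K), w.valuation K k ≤ 1) :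
    Real.fourierChar ((Algebra.trace ℚ K k : ℚ) : ℝ) = 1 := by
  obtain ⟨a, rfl⟩ := HeightOneSpectrum.mem_integers_of_valuation_le_one (R := 𝓞 K) K k h
  have hi : IsIntegral ℤ (Algebra.trace ℚ K (algebraMap (𝓞 K) K a)) :=
    Algebra.isIntegral_trace (RingOfIntegers.isIntegral_coe a)
  obtain ⟨m, hm⟩ := IsIntegrallyClosed.isIntegral_iff.1 hi
  rw [← hm]
  ext
  simp [Real.fourierChar_apply, Complex.exp_eq_one_iff]
  exact ⟨m, by ring⟩

theorem fourierChar_trace_eq {K : Type*} [Field K] [NumberField K] {v : HeightOneSpectrum (𝓞 K)}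
    {x : v.adicCompletion K} {k k' : K} (h : IsPolarPart v x k) (h' : IsPolarPart v x k') :
    Real.fourierChar ((Algebra.trace ℚ K k : ℚ) : ℝ) =
      Real.fourierChar ((Algebra.trace ℚ K k' : ℚ) : ℝ) := by
  have key := fourierChar_trace_eq_one (k - k') (fun w => ?_)
  · rw [map_sub, Rat.cast_sub, AddChar.map_sub_eq_div, div_eq_one] at key
    exact key
  · by_cases hw : w = v
    · subst hw
      rw [← valued_algebraMap]
      have : algebraMap K (w.adicCompletion K) (k - k') =
          (x - algebraMap K (w.adicCompletion K) k') -
            (x - algebraMap K (w.adicCompletion K) k) := by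
        rw [map_sub]; ring
      rw [this]
      exact (Valued.v.map_sub _ _).trans (max_le h'.1 h.1)
    · exact ((w.valuation K).map_sub _ _).trans (max_le (h.2 w hw) (h'.2 w hw))

/-- The standard additive character `ψ_v` of the completion `K_v` at a finite place `v`.
The standard character `ψ = ψ_∞ ∏_v ψ_v` of the adeles is trivial on `K`, its finite components are
trivial on the local integers (as they are trivial on the inverse different), and
`ψ_∞(x) = e(-Tr x)`. If `k ∈ K` is a polar part of `x` at `v`
(see `IsPolarPart`; it exists by `exists_isPolarPart`), evaluating `ψ` at the principal adele `k`
therefore gives `ψ_v(x) = ψ_v(k) = ψ_∞(k)⁻¹ = e(Tr k)`. This is the definition used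
here; it does not depend on the choice of `k` by `fourierChar_trace_eq`, and
`psiInf_mixedEmbedding` and `finprod_psiLoc` confirm that `ψ` is trivial on `K`. -/
def psiLoc {K : Type*} [Field K] [NumberField K] (v : HeightOneSpectrum (𝓞 K)) :
    AddChar (v.adicCompletion K) Circle where
  toFun x := Real.fourierChar ((Algebra.trace ℚ K (exists_isPolarPart v x).choose : ℚ) : ℝ)
  map_zero_eq_one' := by
    rw [fourierChar_trace_eq (exists_isPolarPart v 0).choose_spec (k' := 0)
      ⟨by simp, by simp⟩]
    simp
  map_add_eq_mul' x y := by
    have hx := (exists_isPolarPart v x).choose_spec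
    have hy := (exists_isPolarPart v y).choose_spec
    rw [fourierChar_trace_eq (exists_isPolarPart v (x + y)).choose_spec
      (k' := (exists_isPolarPart v x).choose + (exists_isPolarPart v y).choose) ⟨?_, ?_⟩]
    · rw [map_add, Rat.cast_add, AddChar.map_add_eq_mul]
    · rw [map_add, add_sub_add_comm]
      exact (Valued.v.map_add _ _).trans (max_le hx.1 hy.1)
    · intro w hw
      exact ((w.valuation K).map_add _ _).trans (max_le (hx.2 w hw) (hy.2 w hw))

theorem psiLoc_eq {K : Type*} [Field K] [NumberField K] {v : HeightOneSpectrum (𝓞 K)}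
    {x : v.adicCompletion K} {k : K} (h : IsPolarPart v x k) :
    psiLoc v x = Real.fourierChar ((Algebra.trace ℚ K k : ℚ) : ℝ) :=
  fourierChar_trace_eq (exists_isPolarPart v x).choose_spec h

theorem fourierChar_sum {ι : Type*} (s : Finset ι) (f : ι → ℝ) :
    Real.fourierChar (∑ i ∈ s, f i) = ∏ i ∈ s, Real.fourierChar (f i) := by
  classical
  induction s using Finset.induction_on with
  | empty => simp
  | insert a s ha ih => rw [Finset.sum_insert ha, Finset.prod_insert ha, AddChar.map_add_eq_mul, ih]

theorem circle_coe_prod {ι : Type*} (s : Finset ι) (f : ι → Circle) :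
    ((∏ i ∈ s, f i : Circle) : ℂ) = ∏ i ∈ s, (f i : ℂ) :=
  map_prod Circle.coeHom f s

/-- On `K` the archimedean part is `e(-Tr x)`. -/
theorem psiInf_mixedEmbedding {K : Type*} [Field K] [NumberField K] (x : K) :
    psiInf (mixedEmbedding K x) =
      (Real.fourierChar (-((Algebra.trace ℚ K x : ℚ) : ℝ)) : ℂ) := by
  classical
  have htr : ((Algebra.trace ℚ K x : ℚ) : ℝ) =
      ∑ w : InfinitePlace K, (w.mult : ℝ) * (w.embedding x).re := by
    have h := congrArg Complex.re (trace_eq_sum_embeddings (K := ℚ) (E := ℂ) (x := x))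
    rw [eq_ratCast, Complex.ratCast_re, Complex.re_sum,
      ← Fintype.sum_equiv (RingHom.equivRatAlgHom K ℂ) (fun f => (f x).re)
      (fun φ => (φ x).re) fun _ => by simp [RingHom.equivRatAlgHom_apply]] at h
    rw [h, ← Finset.sum_fiberwise Finset.univ InfinitePlace.mk (fun φ => (φ x).re)]
    refine Finset.sum_congr rfl fun w _ => ?_
    have (φ) (hφ : φ ∈ ({φ | InfinitePlace.mk φ = w} : Finset (K →+* ℂ))) :
        (φ x).re = (w.embedding x).re := by
      have := (Finset.mem_filter.mp hφ).2
      rw [← InfinitePlace.mk_embedding w, InfinitePlace.mk_eq_iff] at this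
      rcases this with h | h
      · rw [h]
      · rw [← h]; simp
    rw [Finset.sum_congr rfl this, Finset.sum_const, InfinitePlace.card_filter_mk_eq, nsmul_eq_mul]
  have key : Real.fourierChar (-((Algebra.trace ℚ K x : ℚ) : ℝ)) =
      ∏ w : InfinitePlace K, Real.fourierChar (-((w.mult : ℝ) * (w.embedding x).re)) := by
    rw [htr, ← Finset.sum_neg_distrib]
    exact fourierChar_sum _ _
  rw [key, InfinitePlace.prod_eq_prod_mul_prod, psiInf]
  rw [Circle.coe_mul]
  rw [circle_coe_prod, circle_coe_prod]
  congr 1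
  · refine Finset.prod_congr (by congr) fun w _ => ?_
    rw [mixedEmbedding.mixedEmbedding_apply_isReal, InfinitePlace.mult_isReal, Nat.cast_one, one_mul]
    congr 3
  · refine Finset.prod_congr (by congr) fun w _ => ?_
    rw [mixedEmbedding.mixedEmbedding_apply_isComplex, InfinitePlace.mult_isComplex]
    congr 3
    simp; ring

theorem finite_not_integral {K : Type*} [Field K] [NumberField K] (x : K) :
    {v : HeightOneSpectrum (𝓞 K) | ¬ v.valuation K x ≤ 1}.Finite := by
  obtain ⟨a, s, hs, rfl⟩ := IsFractionRing.div_surjective (𝓞 K) x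
  have hs0 : s ≠ 0 := nonZeroDivisors.ne_zero hs
  refine (Ideal.finite_factors (I := Ideal.span {s}) (by simpa using hs0)).subset ?_
  intro v hv
  by_contra h
  apply hv
  have : s ∉ v.asIdeal := fun h' => h (by
    rw [Set.mem_ofPred_eq, Ideal.dvd_span_singleton]; exact h')
  have h1 : v.valuation K (algebraMap (𝓞 K) K s) = 1 := by
    rw [HeightOneSpectrum.valuation_eq_one_iff_notMem]; exact this
  rw [map_div₀, h1, div_one]
  exact v.valuation_le_one a

/-- The finite components multiply to `e(Tr x)` on `K`: the character `ψ_∞ ∏_v ψ_v` is trivial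
on `K`. -/
theorem finprod_psiLoc {K : Type*} [Field K] [NumberField K] (x : K) :
    ∏ᶠ v : HeightOneSpectrum (𝓞 K), psiLoc v (algebraMap K (v.adicCompletion K) x) =
      Real.fourierChar ((Algebra.trace ℚ K x : ℚ) : ℝ) := by
  classical
  choose k hk using fun v : HeightOneSpectrum (𝓞 K) =>
    exists_isPolarPart v (algebraMap K (v.adicCompletion K) x)
  set S := (finite_not_integral x).toFinset
  have h1 : ∀ v ∉ S, psiLoc v (algebraMap K (v.adicCompletion K) x) = 1 := by
    intro v hv
    have hv : v.valuation K x ≤ 1 := by simpa [S] using hv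
    have : IsPolarPart v (algebraMap K (v.adicCompletion K) x) 0 :=
      ⟨by simpa [valued_algebraMap] using hv, by simp⟩
    rw [psiLoc_eq this]; simp
  rw [finprod_eq_prod_of_mulSupport_subset (s := S) _ (fun v hv => by
    by_contra h; exact hv (h1 v h)), Finset.prod_congr rfl fun v _ => psiLoc_eq (hk v),
    ← fourierChar_sum, ← Rat.cast_sum, ← map_sum, eq_comm, ← div_eq_one,
    ← AddChar.map_sub_eq_div, ← Rat.cast_sub, ← map_sub]
  apply fourierChar_trace_eq_one
  intro w
  by_cases hw : w ∈ S
  · rw [← Finset.add_sum_erase _ _ hw, ← sub_sub]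
    refine ((w.valuation K).map_sub _ _).trans (max_le ?_ ?_)
    · rw [← valued_algebraMap, map_sub]; exact (hk w).1
    · exact (w.valuation K).map_sum_le fun v hv => (hk v).2 w (Finset.ne_of_mem_erase hv).symm
  · refine ((w.valuation K).map_sub _ _).trans (max_le (by simpa [S] using hw) ?_)
    exact (w.valuation K).map_sum_le fun v hv => (hk v).2 w (by rintro rfl; exact hw hv)
/-- For a nonzero integral ideal `𝔟`, the value at `x ∈ K` of `ψ_𝔟 = ∏_{𝔭_v ∣ 𝔟} ψ_v`. -/
def psiIdeal {K : Type*} [Field K] [NumberField K] (𝔟 : Ideal (𝓞 K)) (x : K) : ℂ :=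
  ∏ᶠ (v : HeightOneSpectrum (𝓞 K)) (_ : v.asIdeal ∣ 𝔟),
    (psiLoc v (algebraMap K (v.adicCompletion K) x) : ℂ)

/-! ### Unit classes modulo an ideal and their inverses -/

/-- The `𝓞 K`-module `𝔟 / 𝔮`, for fractional ideals `𝔮 ⊆ 𝔟`. -/
abbrev IdealQuotient {K : Type*} [Field K] [NumberField K] (𝔟 𝔮 : FracIdeal K) :=
  (𝔟 : Submodule (𝓞 K) K) ⧸ (𝔮 : Submodule (𝓞 K) K).submoduleOf (𝔟 : Submodule (𝓞 K) K)

/-- `(𝔟 / 𝔮)^×`: the classes that generate `𝔟 / 𝔮` as an `𝓞 K`-module. -/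
def unitClasses {K : Type*} [Field K] [NumberField K] (𝔟 𝔮 : FracIdeal K) :
    Set (IdealQuotient 𝔟 𝔮) :=
  {X | Submodule.span (𝓞 K) {X} = ⊤}

/-- A representative in `K` of a class in `𝔟 / 𝔮`. -/
def rep {K : Type*} [Field K] [NumberField K] {𝔟 𝔮 : FracIdeal K} (X : IdealQuotient 𝔟 𝔮) : K :=
  ((Submodule.mkQ_surjective _ X).choose : (𝔟 : Submodule (𝓞 K) K))

/-- `Y ∈ (𝔟⁻¹ / 𝔮𝔟⁻²)^×` is the inverse of `X ∈ 𝔟 / 𝔮` if `x y ∈ 1 + 𝔮𝔟⁻¹` for all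
representatives `x` of `X` and `y` of `Y`. -/
def IsInverseClass {K : Type*} [Field K] [NumberField K] {𝔟 𝔮 : FracIdeal K}
    (X : IdealQuotient 𝔟 𝔮) (Y : IdealQuotient 𝔟⁻¹ (𝔮 * (𝔟⁻¹) ^ 2)) : Prop :=
  Y ∈ unitClasses 𝔟⁻¹ (𝔮 * (𝔟⁻¹) ^ 2) ∧
    ∀ (x : (𝔟 : Submodule (𝓞 K) K)) (y : ((𝔟⁻¹ : FracIdeal K) : Submodule (𝓞 K) K)),
      Submodule.Quotient.mk x = X → Submodule.Quotient.mk y = Y →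
        (x : K) * (y : K) - 1 ∈ 𝔮 * 𝔟⁻¹

theorem mk_eq_mk_iff {K : Type*} [Field K] [NumberField K] {𝔟 𝔮 : FracIdeal K}
    (x y : (𝔟 : Submodule (𝓞 K) K)) :
    (Submodule.Quotient.mk x : IdealQuotient 𝔟 𝔮) = Submodule.Quotient.mk y ↔
      (x : K) - (y : K) ∈ 𝔮 :=
  Submodule.Quotient.eq _

theorem existsUnique_inverseClass {K : Type*} [Field K] [NumberField K] {𝔟 𝔮 : FracIdeal K}
    (h𝔟 : 𝔟 ≠ 0) {X : IdealQuotient 𝔟 𝔮} (hX : X ∈ unitClasses 𝔟 𝔮) :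
    ∃! Y : IdealQuotient 𝔟⁻¹ (𝔮 * (𝔟⁻¹) ^ 2), IsInverseClass X Y := by
  obtain ⟨x, rfl⟩ := Submodule.mkQ_surjective _ X
  have hgen : ∀ u ∈ 𝔟, ∃ r : 𝓞 K, u - r • (x : K) ∈ 𝔮 := by
    intro u hu
    have hmem : Submodule.Quotient.mk (⟨u, hu⟩ : (𝔟 : Submodule (𝓞 K) K)) ∈
        Submodule.span (𝓞 K) {(Submodule.Quotient.mk x : IdealQuotient 𝔟 𝔮)} := by
      have : Submodule.span (𝓞 K) {(Submodule.Quotient.mk x : IdealQuotient 𝔟 𝔮)} = ⊤ := hX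
      rw [this]; trivial
    obtain ⟨r, hr⟩ := Submodule.mem_span_singleton.1 hmem
    rw [← Submodule.Quotient.mk_smul, eq_comm, Submodule.Quotient.eq] at hr
    exact ⟨r, hr⟩
  have hle : 𝔟 ≤ FractionalIdeal.spanSingleton (𝓞 K)⁰ (x : K) + 𝔮 := by
    intro u hu
    obtain ⟨r, hr⟩ := hgen u hu
    rw [FractionalIdeal.mem_add]
    exact ⟨r • (x : K), (FractionalIdeal.mem_spanSingleton _).2 ⟨r, rfl⟩, _, hr, by ring⟩
  have hone : (1 : K) ∈ FractionalIdeal.spanSingleton (𝓞 K)⁰ (x : K) * 𝔟⁻¹ + 𝔮 * 𝔟⁻¹ := by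
    rw [← add_mul]
    have h1 : (1 : FracIdeal K) ≤ (FractionalIdeal.spanSingleton (𝓞 K)⁰ (x : K) + 𝔮) * 𝔟⁻¹ := by
      rw [← mul_inv_cancel₀ h𝔟]
      exact mul_le_mul_left hle _
    exact h1 (FractionalIdeal.one_mem_one _)
  obtain ⟨_, h1, z, hz, hsum⟩ := FractionalIdeal.mem_add _ _ _ |>.1 hone
  obtain ⟨y, hy, rfl⟩ := FractionalIdeal.mem_singleton_mul.1 h1
  have hB : 𝔟 * 𝔟⁻¹ = 1 := mul_inv_cancel₀ h𝔟
  have hQ1 : 𝔮 * (𝔟⁻¹) ^ 2 = 𝔟⁻¹ * (𝔮 * 𝔟⁻¹) := by ring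
  have hQ2 : 𝔟 * (𝔮 * (𝔟⁻¹) ^ 2) = 𝔮 * 𝔟⁻¹ := by
    calc 𝔟 * (𝔮 * (𝔟⁻¹) ^ 2) = (𝔟 * 𝔟⁻¹) * (𝔮 * 𝔟⁻¹) := by ring
      _ = 𝔮 * 𝔟⁻¹ := by rw [hB, one_mul]
  refine ⟨Submodule.Quotient.mk ⟨y, hy⟩, ⟨?_, ?_⟩, ?_⟩
  · refine eq_top_iff.2 fun U _ => ?_
    obtain ⟨u, rfl⟩ := Submodule.mkQ_surjective _ U
    have hux : (u : K) * x ∈ (1 : FracIdeal K) := by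
      rw [← hB, mul_comm 𝔟]
      exact FractionalIdeal.mul_mem_mul u.2 x.2
    obtain ⟨r, hr⟩ := (FractionalIdeal.mem_one_iff _).1 hux
    refine Submodule.mem_span_singleton.2 ⟨r, ?_⟩
    rw [← Submodule.Quotient.mk_smul, Submodule.mkQ_apply, eq_comm, Submodule.Quotient.eq]
    change (u : K) - r • y ∈ 𝔮 * (𝔟⁻¹) ^ 2
    have : (u : K) - r • y = u * z := by
      rw [Algebra.smul_def, hr]
      linear_combination -(u : K) * hsum
    rw [this, hQ1]
    exact FractionalIdeal.mul_mem_mul u.2 hz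
  · intro x' y' hx' hy'
    have hx2 : (x' : K) - x ∈ 𝔮 := (mk_eq_mk_iff x' x).1 hx'
    have hy2 : (y' : K) - y ∈ 𝔮 * (𝔟⁻¹) ^ 2 := (mk_eq_mk_iff y' ⟨y, hy⟩).1 hy'
    have : (x' : K) * y' - 1 = -z + (((x' : K) - x) * y' + x * ((y' : K) - y)) := by
      linear_combination hsum
    rw [this]
    have h3 : (x : K) * ((y' : K) - y) ∈ 𝔮 * 𝔟⁻¹ := by
      rw [← hQ2]; exact FractionalIdeal.mul_mem_mul x.2 hy2
    exact Submodule.add_mem _ (Submodule.neg_mem _ hz)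
      (Submodule.add_mem _ (FractionalIdeal.mul_mem_mul hx2 y'.2) h3)
  · rintro Y ⟨-, hY⟩
    obtain ⟨y', rfl⟩ := Submodule.mkQ_surjective _ Y
    have h := hY x y' rfl rfl
    rw [Submodule.mkQ_apply, Submodule.Quotient.eq]
    change (y' : K) - y ∈ 𝔮 * (𝔟⁻¹) ^ 2
    have : (y' : K) - y = y * ((x : K) * y' - 1) + y' * z := by
      linear_combination -(y' : K) * hsum
    rw [this, hQ1]
    exact Submodule.add_mem _ (FractionalIdeal.mul_mem_mul hy h)
      (FractionalIdeal.mul_mem_mul y'.2 hz)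

open scoped Classical in
/-- The inverse `X⁻¹ ∈ (𝔟⁻¹ / 𝔮𝔟⁻²)^×` of a class `X ∈ (𝔟 / 𝔮)^×`; it exists and is unique by
`existsUnique_inverseClass`. -/
def invClass {K : Type*} [Field K] [NumberField K] {𝔟 𝔮 : FracIdeal K}
    (X : IdealQuotient 𝔟 𝔮) : IdealQuotient 𝔟⁻¹ (𝔮 * (𝔟⁻¹) ^ 2) :=
  if h : ∃ Y, IsInverseClass X Y then h.choose else 0

/-! ### Arithmetic of ideals -/

open scoped Classical in
/-- The exact quotient `I J⁻¹` of integral ideals, when `J` divides `I` (and `0` otherwise). -/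
def idealDiv {K : Type*} [Field K] [NumberField K] (I J : Ideal (𝓞 K)) : Ideal (𝓞 K) :=
  if h : J ∣ I then h.choose else 0

open scoped Classical in
/-- The Möbius function on the nonzero ideals of `𝓞 K`. -/
def idealMoebius {K : Type*} [Field K] [NumberField K] (I : Ideal (𝓞 K)) : ℤ :=
  if Squarefree I then (-1) ^ (UniqueFactorizationMonoid.normalizedFactors I).card else 0

/-- The square-free part of an ideal: the product of the primes that divide it exactly once. -/
def squarefreePart {K : Type*} [Field K] [NumberField K] (I : Ideal (𝓞 K)) : Ideal (𝓞 K) :=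
  ∏ᶠ (v : HeightOneSpectrum (𝓞 K)) (_ : v.asIdeal ∣ I ∧ ¬ v.asIdeal ^ 2 ∣ I), v.asIdeal

/-- The part `𝔞_𝔟 = ∏_{𝔭_v ∣ 𝔟} 𝔭_v ^ ord_v(𝔞)` of a fractional ideal `𝔞` supported at the primes
dividing the nonzero integral ideal `𝔟`. -/
def partAt {K : Type*} [Field K] [NumberField K] (𝔞 : FracIdeal K) (𝔟 : Ideal (𝓞 K)) :
    FracIdeal K :=
  ∏ᶠ (v : HeightOneSpectrum (𝓞 K)) (_ : v.asIdeal ∣ 𝔟),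
    ((v.asIdeal : Ideal (𝓞 K)) : FracIdeal K) ^ FractionalIdeal.count K v 𝔞

/-! ### The exponential sums -/

/-- The Kloosterman sum
`Kl_𝔟(α, β; 𝔮) = ∑_{x ∈ ((𝔮𝔇_𝔟)⁻¹ / 𝔇_𝔟⁻¹)^×} ψ_𝔟(α x + β x⁻¹)`, for `𝔮 ∣ 𝔟`. -/
def kloosterman {K : Type*} [Field K] [NumberField K] (𝔟 : Ideal (𝓞 K)) (α β : K)
    (𝔮 : Ideal (𝓞 K)) : ℂ :=
  ∑ᶠ X ∈ unitClasses ((𝔮 : FracIdeal K) * partAt (different K) 𝔟)⁻¹ (partAt (different K) 𝔟)⁻¹,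
    psiIdeal 𝔟 (α * rep X + β * rep (invClass X))

/-- The modulus `𝔟 = (𝔡, 𝔮)⁻¹ 𝔮`. -/
def modulus {K : Type*} [Field K] [NumberField K] (𝔡 𝔮 : Ideal (𝓞 K)) : Ideal (𝓞 K) :=
  idealDiv 𝔮 (𝔡 ⊔ 𝔮)

/-- The exponential sum
`T_𝔡(γ; 𝔮, 𝔮₁) = ∑_x ψ_∞(x⁻¹ / (β c)) Kl_𝔟(1, -γ c / x; 𝔮₁)`, where `x` runs over
`(𝔞𝔡(𝔠𝔇)⁻¹ / 𝔞𝔡(𝔠𝔇)⁻¹𝔮)^×`, `𝔟 = (𝔡, 𝔮)⁻¹ 𝔮`, and `β`, `c` are generators of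
`(𝔠𝔇)²(𝔞𝔡)⁻¹` and `𝔠⁻¹𝔮`. -/
def expSum {K : Type*} [Field K] [NumberField K] (𝔞 𝔠 : FracIdeal K) (𝔡 : Ideal (𝓞 K)) (β c γ : K)
    (𝔮 𝔮₁ : Ideal (𝓞 K)) : ℂ :=
  ∑ᶠ X ∈ unitClasses (𝔞 * (𝔡 : FracIdeal K) * (𝔠 * different K)⁻¹)
      (𝔞 * (𝔡 : FracIdeal K) * (𝔠 * different K)⁻¹ * (𝔮 : FracIdeal K)),
    psiInf (mixedEmbedding K (rep (invClass X) / (β * c))) *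
      kloosterman (modulus 𝔡 𝔮) 1 (-γ * c * rep (invClass X)) 𝔮₁

end VoronoiSum
end

/-!
Put `M = K / 𝔇⁻¹`, on which `e(Tr ·)` is a character, and `δ = β c² γ`. Dividing by `β c` and
taking the component at the primes of `𝔟` turn the two summations into sums over the elements `Y`
and `X` of `M` with annihilators `𝔮` and `𝔮₁`. The summand is `e(X) e(-(1 + w_X) Y)`, where
`w_X ∈ 𝓞` represents `δ / X` at the primes of `𝔟` and vanishes modulo `𝔮` at the other primes.
Summing over `Y` gives the Ramanujan sum `c_𝔮(1 + w_X)`. Since `w_X` lies in `𝔮 𝔮₁⁻¹`, it vanishes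
when `𝔮₁` and `𝔮 𝔮₁⁻¹` share a prime, and otherwise equals `μ(𝔮 𝔮₁⁻¹) c_{𝔮₁}(1 + w_X)`.

In the coprime case `w_X X` is a constant `Δ ∈ M`, the component of `δ` at the primes of `𝔮₁`.
Hence for `𝔣 ∣ 𝔮₁` the condition `1 + w_X ∈ 𝔮₁ 𝔣⁻¹` says that `𝔣` annihilates `X + Δ`. Möbius
inversion over the annihilator of `X` leaves the sums of `e(X)` over the `X` killed by `𝔨` for which
`X + Δ` is killed by `𝔣`. Such a range of summation is empty or a coset of `M[𝔨 + 𝔣]`, so the sum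
is zero unless `𝔨` and `𝔣` are coprime and `𝔨𝔣` kills `Δ`, in which case it is the single term
`ψ_𝔟(-δ) ψ_𝔣(δ)`.
-/

noncomputable section

namespace VoronoiSum

section IdealArithmetic

section DedekindDomain

variable {R : Type*} [CommRing R] [IsDedekindDomain R]

theorem ideal_isRelPrime_iff_isCoprime {I J : Ideal R} : IsRelPrime I J ↔ IsCoprime I J :=
  ⟨fun h => Ideal.isCoprime_iff_sup_eq.2 <| Ideal.isUnit_iff.1 <|
    h (Ideal.dvd_iff_le.2 le_sup_left) (Ideal.dvd_iff_le.2 le_sup_right), IsCoprime.isRelPrime⟩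

theorem isCoprime_of_prime_of_not_dvd {P I : Ideal R} (hP : Prime P) (h : ¬ P ∣ I) :
    IsCoprime P I :=
  ideal_isRelPrime_iff_isCoprime.1 (hP.irreducible.isRelPrime_iff_not_dvd.2 h)

theorem exists_heightOneSpectrum_dvd {I : Ideal R} (hI : I ≠ ⊥) (h1 : I ≠ 1) :
    ∃ v : HeightOneSpectrum R, v.asIdeal ∣ I := by
  obtain ⟨P, hP, hPI⟩ :=
    WfDvdMonoid.exists_irreducible_factor (fun h => h1 (isUnit_iff_eq_one.1 h)) hI
  exact ⟨⟨P, Ideal.isPrime_of_prime hP.prime, hP.ne_zero⟩, hPI⟩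

theorem isCoprime_iff_forall_not_dvd {I J : Ideal R} (hI : I ≠ ⊥) :
    IsCoprime I J ↔ ∀ v : HeightOneSpectrum R, v.asIdeal ∣ I → ¬ v.asIdeal ∣ J := by
  refine ⟨fun h v hvI hvJ => v.prime.not_isUnit (h.isUnit_of_dvd' hvI hvJ), fun h => ?_⟩
  refine ideal_isRelPrime_iff_isCoprime.1
    (WfDvdMonoid.isRelPrime_of_no_irreducible_factors (fun h0 => hI h0.1) fun P hP hPI => ?_)
  exact h ⟨P, Ideal.isPrime_of_prime hP.prime, hP.ne_zero⟩ hPI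

end DedekindDomain

variable {K : Type*} [Field K] [NumberField K] {a b h q : Ideal (𝓞 K)}

theorem finite_setOf_dvd (ha : a ≠ ⊥) : {h : Ideal (𝓞 K) | h ∣ a}.Finite :=
  have := UniqueFactorizationMonoid.fintypeSubtypeDvd a ha
  Set.finite_coe_iff.1 (Finite.of_fintype {h // h ∣ a})

open scoped Classical in
/-- The finite set of integral ideals dividing `a`; it is given the value `∅` at `a = ⊥`, which has
infinitely many divisors. -/
def idealDivisors (a : Ideal (𝓞 K)) : Finset (Ideal (𝓞 K)) :=
  if ha : a ≠ ⊥ then (finite_setOf_dvd ha).toFinset else ∅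

theorem mem_idealDivisors (ha : a ≠ ⊥) : h ∈ idealDivisors a ↔ h ∣ a := by
  simp [idealDivisors, ha]

theorem idealDiv_mul_cancel (h : b ∣ a) : b * idealDiv a b = a := by
  rw [idealDiv, dif_pos h]
  exact h.choose_spec.symm

theorem idealDiv_eq_of_mul_eq (hb : b ≠ ⊥) (h : b * q = a) : idealDiv a b = q :=
  mul_left_cancel₀ hb ((idealDiv_mul_cancel (Dvd.intro _ h)).trans h.symm)

theorem idealDiv_dvd (h : b ∣ a) : idealDiv a b ∣ a :=
  Dvd.intro_left _ (idealDiv_mul_cancel h)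

theorem idealDiv_ne_bot (ha : a ≠ ⊥) (h : b ∣ a) : idealDiv a b ≠ ⊥ :=
  ne_zero_of_dvd_ne_zero ha (idealDiv_dvd h)

theorem idealDiv_idealDiv (ha : a ≠ ⊥) (h : b ∣ a) : idealDiv a (idealDiv a b) = b :=
  idealDiv_eq_of_mul_eq (idealDiv_ne_bot ha h) (by rw [mul_comm, idealDiv_mul_cancel h])

theorem absNorm_idealDiv (ha : a ≠ ⊥) (h : b ∣ a) :
    (Ideal.absNorm (idealDiv a b) : ℂ) = Ideal.absNorm a / Ideal.absNorm b := by
  have hN : (Ideal.absNorm b : ℂ) ≠ 0 :=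
    Nat.cast_ne_zero.2 (Ideal.absNorm_ne_zero_iff_mem_nonZeroDivisors.2
      (mem_nonZeroDivisors_of_ne_zero (ne_zero_of_dvd_ne_zero ha h)))
  rw [eq_div_iff hN, ← Nat.cast_mul, ← map_mul, mul_comm, idealDiv_mul_cancel h]

theorem dvd_idealDiv_iff (ha : a ≠ ⊥) (h : b ∣ a) : q ∣ idealDiv a b ↔ b * q ∣ a := by
  conv_rhs => rw [← idealDiv_mul_cancel h]
  exact (mul_dvd_mul_iff_left (ne_zero_of_dvd_ne_zero ha h)).symm

theorem sum_idealDivisors_idealDiv {M : Type*} [AddCommMonoid M] (a : Ideal (𝓞 K))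
    (f : Ideal (𝓞 K) → M) :
    ∑ h ∈ idealDivisors a, f (idealDiv a h) = ∑ h ∈ idealDivisors a, f h := by
  by_cases ha : a = ⊥
  · simp [idealDivisors, ha]
  refine Finset.sum_nbij' (idealDiv a) (idealDiv a) ?_ ?_ ?_ ?_ ?_ <;>
    simp +contextual only [mem_idealDivisors ha, idealDiv_dvd, idealDiv_idealDiv ha, implies_true]

theorem idealMoebius_one : idealMoebius (1 : Ideal (𝓞 K)) = 1 := by
  rw [idealMoebius, if_pos squarefree_one, UniqueFactorizationMonoid.normalizedFactors_one,
    Multiset.card_zero, pow_zero]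

theorem idealMoebius_of_not_squarefree (h : ¬ Squarefree a) : idealMoebius a = 0 :=
  if_neg h

theorem idealMoebius_eq_zero_of_sq_dvd {p : Ideal (𝓞 K)} (hp : Prime p) (h : p ^ 2 ∣ a) :
    idealMoebius a = 0 :=
  idealMoebius_of_not_squarefree fun hs => hp.not_isUnit (hs p (by rwa [← sq]))

theorem idealMoebius_mul (h : IsCoprime a b) :
    idealMoebius (a * b) = idealMoebius a * idealMoebius b := by
  have hiff : Squarefree (a * b) ↔ Squarefree a ∧ Squarefree b := by
    rw [squarefree_mul_iff, and_iff_right h.isRelPrime]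
  by_cases hs : Squarefree (a * b)
  · obtain ⟨ha, hb⟩ := hiff.1 hs
    rw [idealMoebius, idealMoebius, idealMoebius, if_pos hs, if_pos ha, if_pos hb,
      UniqueFactorizationMonoid.normalizedFactors_mul ha.ne_zero hb.ne_zero, Multiset.card_add,
      pow_add]
  · rw [idealMoebius_of_not_squarefree hs, eq_comm, mul_eq_zero]
    exact (not_and_or.1 (mt hiff.2 hs)).imp idealMoebius_of_not_squarefree
      idealMoebius_of_not_squarefree

theorem idealMoebius_prime_mul {p : Ideal (𝓞 K)} (hp : Prime p) (h : ¬ p ∣ a) :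
    idealMoebius (p * a) = -idealMoebius a := by
  rw [idealMoebius_mul (isCoprime_of_prime_of_not_dvd hp h), idealMoebius,
    if_pos hp.irreducible.squarefree,
    UniqueFactorizationMonoid.normalizedFactors_irreducible hp.irreducible]
  simp

theorem sum_idealMoebius_eq_zero (ha : a ≠ ⊥) (h1 : a ≠ 1) :
    ∑ h ∈ idealDivisors a, idealMoebius h = 0 := by
  classical
  obtain ⟨v, hva⟩ := exists_heightOneSpectrum_dvd ha h1
  set p := v.asIdeal
  have hinj : Set.InjOn (p * ·) ((idealDivisors a).filter (¬ p ∣ ·)) :=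
    (mul_right_injective₀ v.ne_bot).injOn
  have hsub : ((idealDivisors a).filter (¬ p ∣ ·)).image (p * ·) ⊆
      (idealDivisors a).filter (p ∣ ·) := by
    simp only [Finset.subset_iff, Finset.mem_image, Finset.mem_filter, mem_idealDivisors ha]
    rintro _ ⟨h, ⟨hha, hph⟩, rfl⟩
    exact ⟨(isCoprime_of_prime_of_not_dvd v.prime hph).mul_dvd hva hha, dvd_mul_right p h⟩
  have hzero : ∀ h ∈ (idealDivisors a).filter (p ∣ ·),
      h ∉ ((idealDivisors a).filter (¬ p ∣ ·)).image (p * ·) → idealMoebius h = 0 := by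
    simp only [Finset.mem_image, Finset.mem_filter, mem_idealDivisors ha]
    rintro _ ⟨hha, c, rfl⟩ hc
    refine idealMoebius_eq_zero_of_sq_dvd v.prime ?_
    rw [sq]
    refine mul_dvd_mul_left p (of_not_not fun hpc => hc ⟨c, ⟨?_, hpc⟩, rfl⟩)
    exact (dvd_mul_left c p).trans hha
  rw [← Finset.sum_filter_add_sum_filter_not _ (p ∣ ·), ← Finset.sum_subset hsub hzero,
    Finset.sum_image hinj, ← Finset.sum_add_distrib]
  refine Finset.sum_eq_zero fun h hh => ?_
  rw [idealMoebius_prime_mul v.prime (Finset.mem_filter.1 hh).2, neg_add_cancel]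

open scoped Classical in
theorem sum_idealMoebius_idealDiv (hq : q ≠ ⊥) (haq : a ∣ q) :
    ∑ k ∈ idealDivisors q with a ∣ k, idealMoebius (idealDiv q k) = if a = q then 1 else 0 := by
  have hqa := idealDiv_ne_bot hq haq
  have hfilter : (idealDivisors q).filter (a ∣ idealDiv q ·) = idealDivisors (idealDiv q a) := by
    ext h
    rw [Finset.mem_filter, mem_idealDivisors hq, mem_idealDivisors hqa, dvd_idealDiv_iff hq haq]
    refine ⟨fun hh => ?_, fun hh => ⟨(dvd_mul_left h a).trans hh, ?_⟩⟩
    · rw [mul_comm]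
      exact (dvd_idealDiv_iff hq hh.1).1 hh.2
    · rwa [dvd_idealDiv_iff hq ((dvd_mul_left h a).trans hh), mul_comm]
  rw [Finset.sum_filter, ← sum_idealDivisors_idealDiv, ← Finset.sum_filter, hfilter]
  have hcancel : ∀ h ∈ idealDivisors (idealDiv q a),
      idealMoebius (idealDiv q (idealDiv q h)) = idealMoebius h := fun h hh => by
    rw [idealDiv_idealDiv hq (((mem_idealDivisors hqa).1 hh).trans (idealDiv_dvd haq))]
  rw [Finset.sum_congr rfl hcancel]
  split_ifs with heq
  · have hone : idealDivisors (1 : Ideal (𝓞 K)) = {1} := by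
      ext h
      rw [mem_idealDivisors one_ne_zero, Finset.mem_singleton, ← isUnit_iff_dvd_one,
        isUnit_iff_eq_one]
    rw [idealDiv_eq_of_mul_eq (q := 1) (heq ▸ hq) (by rw [mul_one, heq]), hone,
      Finset.sum_singleton, idealMoebius_one]
  · refine sum_idealMoebius_eq_zero hqa fun h1 => heq ?_
    rw [← idealDiv_mul_cancel haq, h1, mul_one]

theorem squarefreePart_eq_prod (ha : a ≠ ⊥) :
    ∃ s : Finset (HeightOneSpectrum (𝓞 K)),
      (∀ v, v ∈ s ↔ v.asIdeal ∣ a ∧ ¬ v.asIdeal ^ 2 ∣ a) ∧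
        squarefreePart a = ∏ v ∈ s, v.asIdeal :=
  have hfin : {v : HeightOneSpectrum (𝓞 K) | v.asIdeal ∣ a ∧ ¬ v.asIdeal ^ 2 ∣ a}.Finite :=
    (Ideal.finite_factors ha).subset fun _ hv => hv.1
  ⟨hfin.toFinset, fun v => by simp, finprod_mem_eq_finite_toFinset_prod _ hfin⟩

theorem squarefreePart_dvd (ha : a ≠ ⊥) : squarefreePart a ∣ a := by
  obtain ⟨s, hs, h⟩ := squarefreePart_eq_prod ha
  rw [h]
  exact Finset.prod_dvd_of_coprime (fun v _ w _ hvw => v.isCoprime_of_ne w hvw)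
    fun v hv => ((hs v).1 hv).1

theorem dvd_squarefreePart {f : Ideal (𝓞 K)} (ha : a ≠ ⊥) (hf : Squarefree f)
    (h : ∀ v : HeightOneSpectrum (𝓞 K), v.asIdeal ∣ f → v.asIdeal ∣ a ∧ ¬ v.asIdeal ^ 2 ∣ a) :
    f ∣ squarefreePart a := by
  obtain ⟨s, hs, hsa⟩ := squarefreePart_eq_prod ha
  have hP : ∏ v ∈ s, v.asIdeal ≠ 0 := Finset.prod_ne_zero_iff.2 fun v _ => v.ne_bot
  rw [hsa, UniqueFactorizationMonoid.dvd_iff_normalizedFactors_le_normalizedFactors hf.ne_zero hP,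
    Multiset.le_iff_subset
      ((UniqueFactorizationMonoid.squarefree_iff_nodup_normalizedFactors hf.ne_zero).1 hf)]
  intro p hp
  rw [UniqueFactorizationMonoid.mem_normalizedFactors_iff' hf.ne_zero] at hp
  have hprime : Prime p := hp.1.prime
  exact (UniqueFactorizationMonoid.mem_normalizedFactors_iff' hP).2 ⟨hp.1, hp.2.1,
    Finset.dvd_prod_of_mem (fun v : HeightOneSpectrum (𝓞 K) => v.asIdeal)
      (a := ⟨p, Ideal.isPrime_of_prime hprime, hprime.ne_zero⟩) ((hs _).2 (h _ hp.2.2))⟩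

end IdealArithmetic

section Order

open FractionalIdeal (count)

variable {R : Type*} [CommRing R] [IsDedekindDomain R] {K : Type*} [Field K] [Algebra R K]
  [IsFractionRing R K] {v : HeightOneSpectrum R}

/-- `x ∈ K` has order at least `n ∈ ℤ` at the finite place `v`; this includes `x = 0`. -/
def OrdGe (v : HeightOneSpectrum R) (n : ℤ) (x : K) : Prop :=
  v.valuation K x ≤ WithZero.exp (-n)

namespace OrdGe

variable {m n : ℤ} {x y : K}

theorem add (hx : OrdGe v n x) (hy : OrdGe v n y) : OrdGe v n (x + y) :=
  ((v.valuation K).map_add _ _).trans (max_le hx hy)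

theorem sub (hx : OrdGe v n x) (hy : OrdGe v n y) : OrdGe v n (x - y) :=
  ((v.valuation K).map_sub _ _).trans (max_le hx hy)

theorem mono (hx : OrdGe v n x) (h : m ≤ n) : OrdGe v m x :=
  hx.trans (WithZero.exp_le_exp.2 (neg_le_neg h))

theorem mul (hx : OrdGe v m x) (hy : OrdGe v n y) : OrdGe v (m + n) (x * y) := by
  rw [OrdGe, map_mul, neg_add, WithZero.exp_add]
  exact mul_le_mul' hx hy

end OrdGe

theorem ordGe_zero (v : HeightOneSpectrum R) (n : ℤ) : OrdGe v n (0 : K) := by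
  simp [OrdGe]

theorem ordGe_neg_iff {n : ℤ} {x : K} : OrdGe v n (-x) ↔ OrdGe v n x := by
  rw [OrdGe, OrdGe, Valuation.map_neg]

theorem ordGe_zero_iff {x : K} : OrdGe v 0 x ↔ v.valuation K x ≤ 1 := by
  simp [OrdGe]

theorem ordGe_algebraMap (v : HeightOneSpectrum R) (a : R) : OrdGe v 0 (algebraMap R K a) :=
  ordGe_zero_iff.2 (v.valuation_le_one a)

theorem ordGe_algebraMap_iff_mem_pow {n : ℕ} {a : R} :
    OrdGe v n (algebraMap R K a) ↔ a ∈ v.asIdeal ^ n := by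
  rw [OrdGe, HeightOneSpectrum.valuation_of_algebraMap, v.intValuation_le_pow_iff_mem]

theorem ordGe_mul_iff {m : ℤ} {a : K} (ha : v.valuation K a = WithZero.exp (-m)) (n : ℤ) (x : K) :
    OrdGe v (m + n) (a * x) ↔ OrdGe v n x := by
  rw [OrdGe, OrdGe, map_mul, ha, neg_add, WithZero.exp_add]
  exact mul_le_mul_iff_of_pos_left WithZero.exp_pos

theorem valuation_eq_exp_count {a : R} (ha : a ≠ 0) :
    v.valuation K (algebraMap R K a) =
      WithZero.exp (-count K v (Ideal.span {a} : Ideal R)) := by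
  classical
  rw [HeightOneSpectrum.valuation_of_algebraMap, HeightOneSpectrum.intValuation_if_neg _ ha,
    FractionalIdeal.count_coe K v (by simpa using ha)]

theorem count_pos_iff_dvd {I : Ideal R} (hI : I ≠ ⊥) : 0 < count K v I ↔ v.asIdeal ∣ I := by
  classical
  rw [FractionalIdeal.count_coe K v hI, Nat.cast_pos, Nat.pos_iff_ne_zero]
  exact Associates.count_ne_zero_iff_dvd hI v.irreducible

theorem count_eq_zero_of_not_dvd {I : Ideal R} (hI : I ≠ ⊥) (h : ¬ v.asIdeal ∣ I) :
    count K v I = 0 :=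
  ((FractionalIdeal.count_coe_nonneg K v I).eq_of_not_lt (mt (count_pos_iff_dvd hI).1 h)).symm

theorem count_le_of_dvd {I J : Ideal R} (hI : I ≠ ⊥) (h : J ∣ I) : count K v J ≤ count K v I :=
  FractionalIdeal.count_mono K v (FractionalIdeal.coeIdeal_ne_zero.2 hI)
    ((FractionalIdeal.coeIdeal_le_coeIdeal K).2 (Ideal.dvd_iff_le.1 h))

theorem count_coeIdeal_mul {I J : Ideal R} (hI : I ≠ ⊥) (hJ : J ≠ ⊥) :
    count K v ((I * J : Ideal R) : FractionalIdeal R⁰ K) = count K v I + count K v J := by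
  rw [FractionalIdeal.coeIdeal_mul, FractionalIdeal.count_mul K v
    (FractionalIdeal.coeIdeal_ne_zero.2 hI) (FractionalIdeal.coeIdeal_ne_zero.2 hJ)]

theorem mem_iff_forall_ordGe_algebraMap (K : Type*) [Field K] [Algebra R K] [IsFractionRing R K]
    {I : Ideal R} (hI : I ≠ ⊥) {a : R} :
    a ∈ I ↔ ∀ v : HeightOneSpectrum R, OrdGe v (count K v I) (algebraMap R K a) := by
  classical
  conv_lhs => rw [← Ideal.iInf_maxPowDividing_eq hI, Ideal.mem_iInf]
  refine forall_congr' fun v => ?_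
  rw [FractionalIdeal.count_coe K v hI, ordGe_algebraMap_iff_mem_pow]
  rfl

theorem mem_coeIdeal_iff_forall_ordGe {I : Ideal R} (hI : I ≠ ⊥) {x : K} :
    x ∈ (I : FractionalIdeal R⁰ K) ↔ ∀ v : HeightOneSpectrum R, OrdGe v (count K v I) x := by
  rw [FractionalIdeal.mem_coeIdeal]
  constructor
  · rintro ⟨a, ha, rfl⟩
    exact (mem_iff_forall_ordGe_algebraMap K hI).1 ha
  · intro h
    obtain ⟨a, rfl⟩ := HeightOneSpectrum.mem_integers_of_valuation_le_one (R := R) K x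
      fun v => ordGe_zero_iff.1 ((h v).mono (FractionalIdeal.count_coe_nonneg K v I))
    exact ⟨a, (mem_iff_forall_ordGe_algebraMap K hI).2 h, rfl⟩

theorem mem_iff_forall_ordGe {I : FractionalIdeal R⁰ K} (hI : I ≠ 0) {x : K} :
    x ∈ I ↔ ∀ v : HeightOneSpectrum R, OrdGe v (count K v I) x := by
  obtain ⟨a, J, ha, hIJ⟩ := FractionalIdeal.exists_eq_spanSingleton_mul I
  have haK : algebraMap R K a ≠ 0 := (map_ne_zero_iff _ (IsFractionRing.injective R K)).2 ha
  have hspan : ((Ideal.span {a} : Ideal R) : FractionalIdeal R⁰ K) ≠ 0 :=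
    FractionalIdeal.coeIdeal_ne_zero.2 (by simpa using ha)
  have hJI : ((Ideal.span {a} : Ideal R) : FractionalIdeal R⁰ K) * I = J := by
    rw [hIJ, FractionalIdeal.coeIdeal_span_singleton, ← mul_assoc,
      FractionalIdeal.spanSingleton_mul_spanSingleton, mul_inv_cancel₀ haK,
      FractionalIdeal.spanSingleton_one, one_mul]
  have hJ : J ≠ ⊥ := by
    rintro rfl
    exact mul_ne_zero hspan hI (by simpa using hJI)
  have hmem : x ∈ I ↔ algebraMap R K a * x ∈ (J : FractionalIdeal R⁰ K) := by
    rw [hIJ, FractionalIdeal.mem_singleton_mul]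
    constructor
    · rintro ⟨y, hy, rfl⟩
      rwa [mul_inv_cancel_left₀ haK]
    · intro h
      exact ⟨_, h, (inv_mul_cancel_left₀ haK x).symm⟩
  rw [hmem, mem_coeIdeal_iff_forall_ordGe hJ]
  refine forall_congr' fun v => ?_
  rw [← hJI, FractionalIdeal.count_mul K v hspan hI, ordGe_mul_iff (valuation_eq_exp_count ha)]

theorem finite_not_ordGe_count (I : FractionalIdeal R⁰ K) (x : K) :
    {v : HeightOneSpectrum R | ¬ OrdGe v (count K v I) x}.Finite := by
  refine ((HeightOneSpectrum.Support.finite R x).union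
    (Filter.eventually_cofinite.1 (FractionalIdeal.finite_factors I))).subset fun v hv => ?_
  by_contra h
  simp only [Set.mem_union, HeightOneSpectrum.Support, Set.mem_ofPred_eq, not_or, not_not,
    not_lt] at h
  exact hv (h.2 ▸ ordGe_zero_iff.2 h.1)

theorem exists_nat_ordGe_mul (v : HeightOneSpectrum R) (m : ℤ) (x : K) :
    ∃ n : ℕ, ∀ z : K, OrdGe v n z → OrdGe v m (x * z) := by
  obtain rfl | hx := eq_or_ne x 0
  · exact ⟨0, fun z _ => by simpa using ordGe_zero v m⟩
  obtain ⟨k, hk⟩ : ∃ k : ℤ, OrdGe v k x := ⟨-WithZero.log (v.valuation K x), by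
    rw [OrdGe, neg_neg, WithZero.exp_log ((Valuation.ne_zero_iff _).2 hx)]⟩
  exact ⟨(m - k).toNat, fun z hz => (hk.mul hz).mono (by omega)⟩

theorem exists_ordGe_sub_and_ordGe (S : Set (HeightOneSpectrum R)) (I : FractionalIdeal R⁰ K)
    (x : K) :
    ∃ y : K, (∀ v ∈ S, OrdGe v (count K v I) (y - x)) ∧ ∀ v ∉ S, OrdGe v (count K v I) y := by
  classical
  choose n hn using fun v => exists_nat_ordGe_mul v (count K v I) x
  set B := (finite_not_ordGe_count I x).toFinset
  obtain ⟨e, he⟩ := IsDedekindDomain.exists_forall_sub_mem_ideal (s := B)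
    (fun v : HeightOneSpectrum R => v.asIdeal) n (fun v _ => v.prime)
    (fun v _ w _ hvw h => hvw (HeightOneSpectrum.ext h))
    (fun v => if (v : HeightOneSpectrum R) ∈ S then 1 else 0)
  have hmul : ∀ v (a : R), (v ∈ B → a ∈ v.asIdeal ^ n v) →
      OrdGe v (count K v I) (x * algebraMap R K a) := fun v a ha => by
    by_cases hB : v ∈ B
    · exact hn v _ (ordGe_algebraMap_iff_mem_pow.2 (ha hB))
    · have hx : OrdGe v (count K v I) x := by simpa [B] using hB
      simpa using hx.mul (ordGe_algebraMap v a)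
  refine ⟨x * algebraMap R K e, fun v hv => ?_, fun v hv => hmul v e fun hB => ?_⟩
  · have hsub : x * algebraMap R K e - x = x * algebraMap R K (e - 1) := by
      rw [map_sub, map_one, mul_sub, mul_one]
    rw [hsub]
    exact hmul v _ fun hB => by simpa [hv] using he v hB
  · simpa [hv] using he v hB

end Order

section LocalParts

open FractionalIdeal (count)

variable {K : Type*} [Field K] [NumberField K] {v : HeightOneSpectrum (𝓞 K)}

theorem different_ne_zero : different K ≠ 0 :=
  FractionalIdeal.coeIdeal_ne_zero.2 differentIdeal_ne_bot

open scoped Classical in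
theorem count_partAt (I : FracIdeal K) {b : Ideal (𝓞 K)} (hb : b ≠ ⊥) :
    count K v (partAt I b) = if v.asIdeal ∣ b then count K v I else 0 := by
  have h : partAt I b = ∏ᶠ w : HeightOneSpectrum (𝓞 K), (w.asIdeal : FracIdeal K) ^
      (if w.asIdeal ∣ b then count K w I else 0) :=
    finprod_congr fun w => by by_cases hw : w.asIdeal ∣ b <;> simp [hw]
  rw [h, FractionalIdeal.count_finprod]
  exact Filter.eventually_cofinite.2 <| (Ideal.finite_factors hb).subset fun w hw =>
    of_not_not fun hwb => hw (if_neg hwb)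

theorem partAt_ne_zero (I : FracIdeal K) (b : Ideal (𝓞 K)) : partAt I b ≠ 0 := by
  have hmul : ∀ J L : FracIdeal K, J ≠ 0 → L ≠ 0 → J * L ≠ 0 := fun _ _ => mul_ne_zero
  exact finprod_induction (· ≠ 0) one_ne_zero hmul fun w =>
    finprod_induction (· ≠ 0) one_ne_zero hmul fun _ =>
      zpow_ne_zero _ (FractionalIdeal.coeIdeal_ne_zero.2 w.ne_bot)

end LocalParts

section Characters

open FractionalIdeal (count)

variable {K : Type*} [Field K] [NumberField K] {v : HeightOneSpectrum (𝓞 K)} {b : Ideal (𝓞 K)}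
  {x : K}

variable (K) in
/-- The additive character `x ↦ e(Tr x)` of `K`, which is the inverse of `ψ_∞` and the product of
the `ψ_v` over the finite places. -/
def traceChar : AddChar K ℂ :=
  (Circle.coeHom.compAddChar Real.fourierChar).compAddMonoidHom
    ((Rat.castHom ℝ : ℚ →+ ℝ).comp (Algebra.trace ℚ K : K →+ ℚ))

theorem traceChar_apply (x : K) :
    traceChar K x = Real.fourierChar ((Algebra.trace ℚ K x : ℚ) : ℝ) :=
  rfl

theorem psiInf_mixedEmbedding_eq_traceChar (x : K) :
    psiInf (mixedEmbedding K x) = traceChar K (-x) := by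
  rw [psiInf_mixedEmbedding, traceChar_apply, map_neg (Algebra.trace ℚ K), Rat.cast_neg]

theorem traceChar_eq_one_iff : traceChar K x = 1 ↔ ∃ m : ℤ, Algebra.trace ℚ K x = m := by
  rw [traceChar_apply, Real.fourierChar_apply, Complex.exp_eq_one_iff]
  refine exists_congr fun m => ?_
  have hexp : ((2 * Real.pi * (Algebra.trace ℚ K x : ℚ) : ℝ) : ℂ) * Complex.I =
      (Algebra.trace ℚ K x : ℚ) * (2 * Real.pi * Complex.I) := by
    push_cast
    ring
  rw [hexp, mul_left_inj' Complex.two_pi_I_ne_zero]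
  norm_cast

theorem mem_different_inv_iff_trace :
    x ∈ (different K)⁻¹ ↔ ∀ a : 𝓞 K, ∃ m : ℤ, Algebra.trace ℚ K (a • x) = m := by
  rw [different, coeIdeal_differentIdeal ℤ ℚ, inv_inv,
    FractionalIdeal.mem_dual (one_ne_zero (α := FracIdeal K))]
  have hform (a : 𝓞 K) : Algebra.traceForm ℚ K x (algebraMap (𝓞 K) K a) =
      Algebra.trace ℚ K (a • x) := by
    rw [Algebra.traceForm_apply, mul_comm, Algebra.smul_def]
  constructor
  · intro h a
    obtain ⟨m, hm⟩ := h (algebraMap (𝓞 K) K a) (FractionalIdeal.coe_mem_one _ a)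
    exact ⟨m, by rw [← hform, ← hm]; simp⟩
  · intro h y hy
    obtain ⟨a, rfl⟩ := (FractionalIdeal.mem_one_iff _).1 hy
    obtain ⟨m, hm⟩ := h a
    exact ⟨m, by rw [hform, hm]; simp⟩

theorem mem_different_inv_iff_traceChar :
    x ∈ (different K)⁻¹ ↔ ∀ a : 𝓞 K, traceChar K (a • x) = 1 := by
  simp only [mem_different_inv_iff_trace, traceChar_eq_one_iff]

theorem traceChar_eq_one_of_mem (hx : x ∈ (different K)⁻¹) : traceChar K x = 1 := by
  simpa using mem_different_inv_iff_traceChar.1 hx 1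

theorem mem_different_inv_iff_ordGe :
    x ∈ (different K)⁻¹ ↔
      ∀ v : HeightOneSpectrum (𝓞 K), OrdGe v (-count K v (different K)) x := by
  rw [mem_iff_forall_ordGe (inv_ne_zero different_ne_zero)]
  simp only [FractionalIdeal.count_inv]

theorem neg_count_different_nonpos (v : HeightOneSpectrum (𝓞 K)) :
    -count K v (different K) ≤ 0 :=
  neg_nonpos.2 (FractionalIdeal.count_coe_nonneg K v _)

theorem psiLoc_eq_one (hx : OrdGe v (-count K v (different K)) x) :
    psiLoc v (algebraMap K (v.adicCompletion K) x) = 1 := by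
  obtain ⟨k, hk⟩ := exists_isPolarPart v (algebraMap K (v.adicCompletion K) x)
  have hkD : k ∈ (different K)⁻¹ := mem_different_inv_iff_ordGe.2 fun w => by
    obtain rfl | hw := eq_or_ne w v
    · have hxk : OrdGe w 0 (x - k) := by
        rw [ordGe_zero_iff, ← valued_algebraMap, map_sub]
        exact hk.1
      simpa using hx.sub (hxk.mono (neg_count_different_nonpos w))
    · exact (ordGe_zero_iff.2 (hk.2 w hw)).mono (neg_count_different_nonpos w)
  rw [psiLoc_eq hk]
  exact Circle.ext (traceChar_eq_one_of_mem hkD)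

theorem psiIdeal_add (hb : b ≠ ⊥) (x y : K) :
    psiIdeal b (x + y) = psiIdeal b x * psiIdeal b y := by
  simp only [psiIdeal, map_add, AddChar.map_add_eq_mul, Circle.coe_mul]
  exact finprod_mem_mul_distrib (Ideal.finite_factors hb)

theorem psiIdeal_eq_of_dvd {b' : Ideal (𝓞 K)} (h : b' ∣ b)
    (hx : ∀ v : HeightOneSpectrum (𝓞 K), v.asIdeal ∣ b → ¬ v.asIdeal ∣ b' →
      OrdGe v (-count K v (different K)) x) : psiIdeal b x = psiIdeal b' x := by
  refine finprod_congr fun v => ?_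
  by_cases hb' : v.asIdeal ∣ b'
  · simp only [hb', hb'.trans h]
  · by_cases hb : v.asIdeal ∣ b
    · simp [hb, hb', psiLoc_eq_one (hx v hb hb')]
    · simp only [hb, hb']

theorem psiIdeal_eq_one
    (hx : ∀ v : HeightOneSpectrum (𝓞 K), v.asIdeal ∣ b → OrdGe v (-count K v (different K)) x) :
    psiIdeal b x = 1 :=
  finprod_mem_eq_one_of_forall_eq_one fun v hv => by rw [psiLoc_eq_one (hx v hv), Circle.coe_one]

theorem psiIdeal_eq_traceChar
    (hx : ∀ v : HeightOneSpectrum (𝓞 K), ¬ v.asIdeal ∣ b →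
      OrdGe v (-count K v (different K)) x) : psiIdeal b x = traceChar K x := by
  classical
  rw [traceChar_apply, ← finprod_psiLoc]
  refine Eq.trans (finprod_congr fun v => ?_)
    (Circle.coeHom.map_finprod_of_injective (fun _ _ h => Circle.ext h) _).symm
  rw [finprod_eq_if]
  split_ifs with hv
  · rfl
  · simp [psiLoc_eq_one (hx v hv)]

end Characters

section Torsion

open Submodule

variable {R M : Type*} [CommRing R] [AddCommGroup M] [Module R M]

theorem mem_torsionBySet_iff_torsionOf_dvd [IsDedekindDomain R] {k : Ideal R} {X : M} :
    X ∈ torsionBySet R M k ↔ Ideal.torsionOf R M X ∣ k := by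
  rw [Ideal.dvd_iff_le, mem_torsionBySet_iff, Subtype.forall]
  exact forall₂_congr fun a _ => (Ideal.mem_torsionOf_iff X a).symm

theorem torsionBySet_sup_eq_torsionBySet_mul {k l : Ideal R} (h : IsCoprime k l) :
    torsionBySet R M k ⊔ torsionBySet R M l = torsionBySet R M (k * l : Ideal R) := by
  rw [sup_torsionBySet_ideal_eq_torsionBySet_inf (hc := Ideal.isCoprime_iff_sup_eq.1 h),
    Ideal.mul_eq_inf_of_isCoprime h]

end Torsion

section DualQuotient

open Submodule (torsionBySet)
open Ideal (torsionOf)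

variable {K : Type*} [Field K] [NumberField K] {k l : Ideal (𝓞 K)}

variable (K) in
/-- The torsion module `K / 𝔇⁻¹`, the quotient of `K` by the largest submodule on which `e(Tr x)`
is trivial. -/
abbrev DualQuotient := K ⧸ (((different K)⁻¹ : FracIdeal K) : Submodule (𝓞 K) K)

variable (K) in
/-- The submodule of the elements of `K / 𝔇⁻¹` annihilated by the ideal `k`. -/
abbrev dualTorsion (k : Ideal (𝓞 K)) : Submodule (𝓞 K) (DualQuotient K) :=
  torsionBySet (𝓞 K) (DualQuotient K) (k : Set (𝓞 K))

variable (K) in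
/-- The character of `K / 𝔇⁻¹` induced by `x ↦ e(Tr x)`. -/
def quotChar : AddChar (DualQuotient K) ℂ :=
  AddChar.toAddMonoidHomEquiv.symm <|
    QuotientAddGroup.lift (((different K)⁻¹ : FracIdeal K) : Submodule (𝓞 K) K).toAddSubgroup
      (AddChar.toAddMonoidHomEquiv (traceChar K)) fun _ hx => traceChar_eq_one_of_mem hx

theorem quotChar_mk (x : K) :
    quotChar K (Submodule.Quotient.mk x : DualQuotient K) = traceChar K x :=
  rfl

theorem dualQuotient_mk_eq_zero {x : K} :
    (Submodule.Quotient.mk x : DualQuotient K) = 0 ↔ x ∈ (different K)⁻¹ :=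
  Submodule.Quotient.mk_eq_zero _

theorem exists_quotChar_smul_ne_one {X : DualQuotient K} (hX : X ≠ 0) :
    ∃ a : 𝓞 K, quotChar K (a • X) ≠ 1 := by
  obtain ⟨x, rfl⟩ := Submodule.Quotient.mk_surjective _ X
  rw [Ne, dualQuotient_mk_eq_zero, mem_different_inv_iff_traceChar, not_forall] at hX
  exact hX

theorem mk_mem_dualTorsion_iff (hk : k ≠ ⊥) {x : K} :
    (Submodule.Quotient.mk x : DualQuotient K) ∈ dualTorsion K k ↔
      x ∈ ((k : FracIdeal K) * different K)⁻¹ := by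
  have hk' : (k : FracIdeal K) ≠ 0 := FractionalIdeal.coeIdeal_ne_zero.2 hk
  rw [Submodule.mem_torsionBySet_iff, mul_inv, ← FractionalIdeal.spanSingleton_le_iff_mem,
    ← mul_le_mul_iff_right₀ (bot_lt_iff_ne_bot.2 hk'), ← mul_assoc, mul_inv_cancel₀ hk', one_mul,
    FractionalIdeal.mul_le]
  simp only [Subtype.forall, ← Submodule.Quotient.mk_smul, dualQuotient_mk_eq_zero]
  constructor
  · rintro h i hi j hj
    obtain ⟨a, ha, rfl⟩ := (FractionalIdeal.mem_coeIdeal _).1 hi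
    obtain ⟨c, rfl⟩ := (FractionalIdeal.mem_spanSingleton _).1 hj
    rw [mul_smul_comm, ← Algebra.smul_def]
    exact Submodule.smul_mem _ _ (h a ha)
  · intro h a ha
    rw [Algebra.smul_def]
    exact h _ (FractionalIdeal.mem_coeIdeal_of_mem _ ha) _
      (FractionalIdeal.mem_spanSingleton_self _ _)

theorem dualTorsion_le_iff (hk : k ≠ ⊥) (hl : l ≠ ⊥) :
    dualTorsion K k ≤ dualTorsion K l ↔ k ∣ l := by
  have hk' : (k : FracIdeal K) ≠ 0 := FractionalIdeal.coeIdeal_ne_zero.2 hk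
  have hl' : (l : FracIdeal K) ≠ 0 := FractionalIdeal.coeIdeal_ne_zero.2 hl
  have hD := inv_ne_zero (different_ne_zero (K := K))
  rw [Ideal.dvd_iff_le, ← FractionalIdeal.coeIdeal_le_coeIdeal (R := 𝓞 K) K,
    ← inv_le_inv₀ (bot_lt_iff_ne_bot.2 hk') (bot_lt_iff_ne_bot.2 hl'),
    ← mul_le_mul_iff_left₀ (bot_lt_iff_ne_bot.2 hD), ← mul_inv, ← mul_inv]
  refine ⟨fun h x hx => ?_, fun h X hX => ?_⟩
  · exact (mk_mem_dualTorsion_iff hl).1 (h ((mk_mem_dualTorsion_iff hk).2 hx))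
  · obtain ⟨x, rfl⟩ := Submodule.Quotient.mk_surjective _ X
    exact (mk_mem_dualTorsion_iff hl).2 (h ((mk_mem_dualTorsion_iff hk).1 hX))

theorem exists_span_eq_dualTorsion (hk : k ≠ ⊥) :
    ∃ X : DualQuotient K, Submodule.span (𝓞 K) {X} = dualTorsion K k := by
  have hle : (different K)⁻¹ ≤ ((k : FracIdeal K) * different K)⁻¹ := fun x hx => by
    rw [← mk_mem_dualTorsion_iff hk, dualQuotient_mk_eq_zero.2 hx]
    exact Submodule.zero_mem _
  obtain ⟨x, hx⟩ := IsDedekindDomain.exists_add_spanSingleton_mul_eq hle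
    (inv_ne_zero different_ne_zero) one_ne_zero
  rw [mul_one] at hx
  refine ⟨Submodule.Quotient.mk x, ?_⟩
  ext Y
  obtain ⟨y, rfl⟩ := Submodule.Quotient.mk_surjective _ Y
  rw [mk_mem_dualTorsion_iff hk, ← hx, FractionalIdeal.mem_add, Submodule.mem_span_singleton]
  constructor
  · rintro ⟨c, hc⟩
    rw [← Submodule.Quotient.mk_smul, eq_comm, Submodule.Quotient.eq] at hc
    exact ⟨_, hc, _, (FractionalIdeal.mem_spanSingleton _).2 ⟨c, rfl⟩, sub_add_cancel y _⟩
  · rintro ⟨i, hi, j, hj, rfl⟩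
    obtain ⟨c, rfl⟩ := (FractionalIdeal.mem_spanSingleton _).1 hj
    exact ⟨c, by rw [Submodule.Quotient.mk_add, dualQuotient_mk_eq_zero.2 hi, zero_add]; rfl⟩

theorem torsionOf_eq_of_span_eq_dualTorsion (hk : k ≠ ⊥) {X : DualQuotient K}
    (hX : Submodule.span (𝓞 K) {X} = dualTorsion K k) : torsionOf (𝓞 K) (DualQuotient K) X = k := by
  ext a
  obtain rfl | ha := eq_or_ne a 0
  · simp only [zero_mem]
  · have hspan : Ideal.span {a} ≠ ⊥ := by simpa using ha
    rw [Ideal.mem_torsionOf_iff, ← Submodule.mem_torsionBy_iff,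
      ← Submodule.torsionBySet_span_singleton_eq, ← Submodule.span_singleton_le_iff_mem, hX,
      ← Ideal.dvd_span_singleton]
    exact dualTorsion_le_iff hk hspan

theorem card_dualTorsion (hk : k ≠ ⊥) : Nat.card (dualTorsion K k) = Ideal.absNorm k := by
  obtain ⟨X, hX⟩ := exists_span_eq_dualTorsion hk
  rw [← hX, Ideal.absNorm_apply, Submodule.cardQuot_apply,
    ← torsionOf_eq_of_span_eq_dualTorsion hk hX]
  exact (Nat.card_congr (Ideal.quotTorsionOfEquivSpanSingleton _ _ X).toEquiv).symm

theorem finite_dualTorsion (hk : k ≠ ⊥) : (dualTorsion K k : Set (DualQuotient K)).Finite := by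
  refine Set.finite_coe_iff.1 (Nat.finite_of_card_ne_zero (α := dualTorsion K k) ?_)
  rwa [card_dualTorsion hk, Ne, Ideal.absNorm_eq_zero_iff]

end DualQuotient

section TorsionSums

open Submodule (torsionBySet)
open Ideal (torsionOf)

theorem sum_eq_zero_of_translate {G R : Type*} [AddGroup G] [Ring R] [NoZeroDivisors R]
    {S : Finset G} {f : G → R} {t : G} {c : R} (hc : c ≠ 1) (hS : ∀ X, X + t ∈ S ↔ X ∈ S)
    (hf : ∀ X, f (X + t) = c * f X) : ∑ X ∈ S, f X = 0 := by
  have hsum : ∑ X ∈ S, f (X + t) = ∑ X ∈ S, f X :=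
    Finset.sum_equiv (Equiv.addRight t) (fun X => (hS X).symm) fun X _ => rfl
  simp only [hf, ← Finset.mul_sum] at hsum
  have hzero : (c - 1) * ∑ X ∈ S, f X = 0 := by rw [sub_mul, one_mul, hsum, sub_self]
  exact (mul_eq_zero.1 hzero).resolve_left (sub_ne_zero.2 hc)

variable {K : Type*} [Field K] [NumberField K] {k l q : Ideal (𝓞 K)} {X Δ : DualQuotient K}

open scoped Classical in
/-- The `k`-torsion of `K / 𝔇⁻¹` as a finite set; it is given the value `∅` at `k = ⊥`, where the
torsion is infinite. -/
def dualTorsionFinset (k : Ideal (𝓞 K)) : Finset (DualQuotient K) :=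
  if hk : k ≠ ⊥ then (finite_dualTorsion hk).toFinset else ∅

theorem mem_dualTorsionFinset (hk : k ≠ ⊥) : X ∈ dualTorsionFinset k ↔ X ∈ dualTorsion K k := by
  simp [dualTorsionFinset, hk]

theorem card_dualTorsionFinset (hk : k ≠ ⊥) :
    (dualTorsionFinset k : Finset (DualQuotient K)).card = Ideal.absNorm k := by
  rw [← card_dualTorsion hk, dualTorsionFinset, dif_pos hk]
  exact (Nat.card_eq_card_finite_toFinset _).symm

open scoped Classical in
theorem sum_quotChar_smul (hk : k ≠ ⊥) (u : 𝓞 K) :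
    ∑ Y ∈ dualTorsionFinset k, quotChar K (u • Y) =
      if u ∈ k then (Ideal.absNorm k : ℂ) else 0 := by
  split_ifs with hu
  · have hone : ∀ Y ∈ dualTorsionFinset k, quotChar K (u • Y) = 1 := fun Y hY => by
      rw [(Submodule.mem_torsionBySet_iff _ _).1 ((mem_dualTorsionFinset hk).1 hY) ⟨u, hu⟩,
        AddChar.map_zero_eq_one]
    rw [Finset.sum_congr rfl hone, Finset.sum_const, card_dualTorsionFinset hk, nsmul_one]
  · obtain ⟨X, hX⟩ := exists_span_eq_dualTorsion hk
    have huX : u • X ≠ 0 := fun h => hu <| by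
      rwa [← torsionOf_eq_of_span_eq_dualTorsion hk hX, Ideal.mem_torsionOf_iff]
    obtain ⟨a, ha⟩ := exists_quotChar_smul_ne_one huX
    have haX : a • X ∈ dualTorsion K k :=
      Submodule.smul_mem _ _ (hX ▸ Submodule.mem_span_singleton_self X)
    refine sum_eq_zero_of_translate (t := a • X) ha (fun Y => ?_) fun Y => ?_
    · rw [mem_dualTorsionFinset hk, mem_dualTorsionFinset hk, Submodule.add_mem_iff_left _ haX]
    · rw [smul_add, AddChar.map_add_eq_mul, smul_comm u a, mul_comm]

open scoped Classical in
/-- The elements of `K / 𝔇⁻¹` whose annihilator is exactly `q` (for `q ≠ ⊥`). -/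
def primitiveFinset (q : Ideal (𝓞 K)) : Finset (DualQuotient K) :=
  {X ∈ dualTorsionFinset q | torsionOf (𝓞 K) (DualQuotient K) X = q}

theorem mem_primitiveFinset (hq : q ≠ ⊥) :
    X ∈ primitiveFinset q ↔ torsionOf (𝓞 K) (DualQuotient K) X = q := by
  rw [primitiveFinset, Finset.mem_filter, mem_dualTorsionFinset hq,
    mem_torsionBySet_iff_torsionOf_dvd]
  exact ⟨And.right, fun h => ⟨h.dvd, h⟩⟩

open scoped Classical in
theorem filter_torsionOf_dvd_dualTorsionFinset (hq : q ≠ ⊥) (hk : k ∣ q) :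
    {X ∈ dualTorsionFinset q | torsionOf (𝓞 K) (DualQuotient K) X ∣ k} = dualTorsionFinset k := by
  ext X
  rw [Finset.mem_filter, mem_dualTorsionFinset hq,
    mem_dualTorsionFinset (ne_zero_of_dvd_ne_zero hq hk), mem_torsionBySet_iff_torsionOf_dvd,
    mem_torsionBySet_iff_torsionOf_dvd]
  exact ⟨And.right, fun h => ⟨h.trans hk, h⟩⟩

theorem sum_primitiveFinset (hq : q ≠ ⊥) (f : DualQuotient K → ℂ) :
    ∑ X ∈ primitiveFinset q, f X =
      ∑ k ∈ idealDivisors q, (idealMoebius (idealDiv q k) : ℂ) *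
        ∑ X ∈ dualTorsionFinset k, f X := by
  classical
  have hmoebius : ∀ X ∈ dualTorsionFinset q,
      (if torsionOf (𝓞 K) (DualQuotient K) X = q then f X else 0) =
        ∑ k ∈ idealDivisors q, if torsionOf (𝓞 K) (DualQuotient K) X ∣ k then
          (idealMoebius (idealDiv q k) : ℂ) * f X else 0 := fun X hX => by
    rw [mem_dualTorsionFinset hq, mem_torsionBySet_iff_torsionOf_dvd] at hX
    rw [← Finset.sum_filter, ← Finset.sum_mul, ← Int.cast_sum, sum_idealMoebius_idealDiv hq hX]
    split_ifs <;> simp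
  rw [primitiveFinset, Finset.sum_filter, Finset.sum_congr rfl hmoebius, Finset.sum_comm]
  refine Finset.sum_congr rfl fun k hk => ?_
  rw [← Finset.sum_filter, filter_torsionOf_dvd_dualTorsionFinset hq ((mem_idealDivisors hq).1 hk),
    Finset.mul_sum]

open scoped Classical in
theorem sum_quotChar_filter_add_mem_eq_zero (hk : k ≠ ⊥)
    (h : ¬ (IsCoprime k l ∧ Δ ∈ dualTorsion K (k * l))) :
    ∑ X ∈ dualTorsionFinset k with X + Δ ∈ dualTorsion K l, quotChar K X = 0 := by
  by_cases hkl : IsCoprime k l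
  · refine Finset.sum_eq_zero fun X hX => absurd ⟨hkl, ?_⟩ h
    rw [Finset.mem_filter, mem_dualTorsionFinset hk] at hX
    refine (torsionBySet_sup_eq_torsionBySet_mul hkl).le ?_
    simpa using sub_mem (Submodule.mem_sup_right hX.2) (Submodule.mem_sup_left hX.1)
  · have hsup : k ⊔ l ≠ ⊥ := ne_bot_of_le_ne_bot hk le_sup_left
    obtain ⟨X, hX⟩ := exists_span_eq_dualTorsion hsup
    have hX0 : X ≠ 0 := by
      rintro rfl
      apply hkl
      rw [Ideal.isCoprime_iff_sup_eq, ← torsionOf_eq_of_span_eq_dualTorsion hsup hX,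
        Ideal.torsionOf_zero]
    obtain ⟨a, ha⟩ := exists_quotChar_smul_ne_one hX0
    have haX : a • X ∈ dualTorsion K (k ⊔ l) :=
      Submodule.smul_mem _ _ (hX ▸ Submodule.mem_span_singleton_self X)
    have hak : a • X ∈ dualTorsion K k :=
      Submodule.torsionBySet_le_torsionBySet_of_subset (SetLike.coe_subset_coe.2 le_sup_left) haX
    have hal : a • X ∈ dualTorsion K l :=
      Submodule.torsionBySet_le_torsionBySet_of_subset (SetLike.coe_subset_coe.2 le_sup_right) haX
    refine sum_eq_zero_of_translate (t := a • X) ha (fun Y => ?_) fun Y => ?_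
    · rw [Finset.mem_filter, Finset.mem_filter, mem_dualTorsionFinset hk,
        mem_dualTorsionFinset hk, add_right_comm, Submodule.add_mem_iff_left _ hak,
        Submodule.add_mem_iff_left _ hal]
    · rw [AddChar.map_add_eq_mul, mul_comm]

open scoped Classical in
theorem sum_quotChar_filter_add_mem_eq (hk : k ≠ ⊥) (hkl : IsCoprime k l)
    (hX : X ∈ dualTorsion K k) (hXΔ : X + Δ ∈ dualTorsion K l) :
    ∑ X ∈ dualTorsionFinset k with X + Δ ∈ dualTorsion K l, quotChar K X = quotChar K X := by
  have hdisj := Submodule.disjoint_torsionBySet_ideal (M := DualQuotient K)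
    (Ideal.isCoprime_iff_sup_eq.1 hkl)
  have hsingle : {X ∈ dualTorsionFinset k | X + Δ ∈ dualTorsion K l} = {X} := by
    refine Finset.eq_singleton_iff_unique_mem.2 ⟨?_, fun Y hY => ?_⟩
    · exact Finset.mem_filter.2 ⟨(mem_dualTorsionFinset hk).2 hX, hXΔ⟩
    · rw [Finset.mem_filter, mem_dualTorsionFinset hk] at hY
      refine sub_eq_zero.1 (Submodule.disjoint_def.1 hdisj _ (sub_mem hY.1 hX) ?_)
      simpa using sub_mem hY.2 hXΔ
  rw [hsingle, Finset.sum_singleton]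

end TorsionSums

section UnitClasses

open Ideal (torsionOf)
open FractionalIdeal (spanSingleton)

variable {K : Type*} [Field K] [NumberField K] {B Q : FracIdeal K} {q : Ideal (𝓞 K)}

theorem rep_mem (X : IdealQuotient B Q) : rep X ∈ B :=
  (Submodule.mkQ_surjective _ X).choose.2

theorem mk_rep (X : IdealQuotient B Q) :
    (Submodule.Quotient.mk ⟨rep X, rep_mem X⟩ : IdealQuotient B Q) = X :=
  (Submodule.mkQ_surjective _ X).choose_spec

theorem coeIdeal_torsionOf_mk (hQ : Q ≠ 0) {z : K} (hz : z ∈ B) :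
    (torsionOf (𝓞 K) (IdealQuotient B Q) (Submodule.Quotient.mk ⟨z, hz⟩) : FracIdeal K) =
      Q * (spanSingleton (𝓞 K)⁰ z + Q)⁻¹ := by
  set C := spanSingleton (𝓞 K)⁰ z + Q with hC
  have hQC : Q ≤ C := le_add_of_nonneg_left bot_le
  have hC0 : 0 < C := (bot_lt_iff_ne_bot.2 hQ).trans_le hQC
  have hle : Q * C⁻¹ ≤ 1 := mul_inv_le_one_of_le₀ hQC bot_le
  have hmem : ∀ u : 𝓞 K, algebraMap (𝓞 K) K u ∈ Q * C⁻¹ ↔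
      u ∈ torsionOf (𝓞 K) (IdealQuotient B Q) (Submodule.Quotient.mk ⟨z, hz⟩) := fun u => by
    have huQ : spanSingleton (𝓞 K)⁰ (algebraMap (𝓞 K) K u) * Q ≤ Q :=
      mul_le_of_le_one_left'
        (FractionalIdeal.spanSingleton_le_iff_mem.2 ((FractionalIdeal.mem_one_iff _).2 ⟨u, rfl⟩))
    rw [← FractionalIdeal.spanSingleton_le_iff_mem, le_mul_inv_iff₀ hC0, hC, mul_add,
      ← FractionalIdeal.sup_eq_add, sup_le_iff, and_iff_left huQ,
      FractionalIdeal.spanSingleton_mul_spanSingleton, FractionalIdeal.spanSingleton_le_iff_mem,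
      ← Algebra.smul_def, Ideal.mem_torsionOf_iff, ← Submodule.Quotient.mk_smul,
      Submodule.Quotient.mk_eq_zero]
    rfl
  ext x
  rw [FractionalIdeal.mem_coeIdeal]
  constructor
  · rintro ⟨u, hu, rfl⟩
    exact (hmem u).2 hu
  · intro hx
    obtain ⟨u, rfl⟩ := (FractionalIdeal.mem_one_iff _).1 (hle hx)
    exact ⟨u, (hmem u).1 hx, rfl⟩

theorem mk_mem_unitClasses_iff (hQB : Q ≤ B) {z : K} (hz : z ∈ B) :
    (Submodule.Quotient.mk ⟨z, hz⟩ : IdealQuotient B Q) ∈ unitClasses B Q ↔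
      spanSingleton (𝓞 K)⁰ z + Q = B := by
  have hle : spanSingleton (𝓞 K)⁰ z + Q ≤ B :=
    sup_le (FractionalIdeal.spanSingleton_le_iff_mem.2 hz) hQB
  rw [← hle.ge_iff_eq, unitClasses, Set.mem_ofPred_eq, eq_top_iff]
  constructor
  · intro h y hy
    obtain ⟨r, hr⟩ := Submodule.mem_span_singleton.1
      (h (Submodule.mem_top (x := Submodule.Quotient.mk ⟨y, hy⟩)))
    rw [← Submodule.Quotient.mk_smul, eq_comm, mk_eq_mk_iff] at hr
    exact (FractionalIdeal.mem_add _ _ _).2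
      ⟨_, (FractionalIdeal.mem_spanSingleton _).2 ⟨r, rfl⟩, _, hr, add_sub_cancel _ _⟩
  · intro h Y _
    rw [← mk_rep Y, Submodule.mem_span_singleton]
    obtain ⟨_, hi, t, ht, hsum⟩ := (FractionalIdeal.mem_add _ _ _).1 (h (rep_mem Y))
    obtain ⟨r, rfl⟩ := (FractionalIdeal.mem_spanSingleton _).1 hi
    refine ⟨r, ?_⟩
    rw [← Submodule.Quotient.mk_smul, eq_comm, mk_eq_mk_iff]
    change rep Y - r • z ∈ Q
    rwa [← hsum, add_sub_cancel_left]

theorem mem_unitClasses_iff_torsionOf_eq (hB : B ≠ 0) (hq : q ≠ ⊥)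
    (hQ : B * (q : FracIdeal K) = Q) {X : IdealQuotient B Q} :
    X ∈ unitClasses B Q ↔ torsionOf (𝓞 K) (IdealQuotient B Q) X = q := by
  have hq' : (q : FracIdeal K) ≠ 0 := FractionalIdeal.coeIdeal_ne_zero.2 hq
  have hQ0 : Q ≠ 0 := hQ ▸ mul_ne_zero hB hq'
  have hQB : Q ≤ B := hQ ▸ mul_le_of_le_one_right' FractionalIdeal.coeIdeal_le_one
  have hC0 : spanSingleton (𝓞 K)⁰ (rep X) + Q ≠ 0 :=
    ne_bot_of_le_ne_bot hQ0 (le_add_of_nonneg_left bot_le)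
  conv_rhs => rw [← mk_rep X]
  conv_lhs => rw [← mk_rep X, mk_mem_unitClasses_iff hQB]
  rw [← FractionalIdeal.coeIdeal_inj (R := 𝓞 K) (K := K), coeIdeal_torsionOf_mk hQ0,
    mul_inv_eq_iff_eq_mul₀ hC0]
  nth_rw 3 [← hQ]
  rw [mul_comm B, mul_right_inj' hq', eq_comm]

theorem mk_mem_unitClasses_of_mul_sub_one_mem (hB : B ≠ 0) {x z : K} (hx : x ∈ B) (hz : z ∈ B⁻¹)
    (hxz : x * z - 1 ∈ Q * B⁻¹) :
    (Submodule.Quotient.mk ⟨x, hx⟩ : IdealQuotient B Q) ∈ unitClasses B Q := by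
  refine eq_top_iff.2 fun Y _ => ?_
  rw [← mk_rep Y, Submodule.mem_span_singleton]
  have hzy : z * rep Y ∈ (1 : FracIdeal K) := by
    rw [← inv_mul_cancel₀ hB]
    exact FractionalIdeal.mul_mem_mul hz (rep_mem Y)
  obtain ⟨r, hr⟩ := (FractionalIdeal.mem_one_iff _).1 hzy
  refine ⟨r, ?_⟩
  rw [← Submodule.Quotient.mk_smul, mk_eq_mk_iff]
  have hdiff : (x * z - 1) * rep Y ∈ Q := by
    simpa only [inv_mul_cancel_right₀ hB] using FractionalIdeal.mul_mem_mul hxz (rep_mem Y)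
  convert hdiff using 1
  change r • x - rep Y = _
  rw [Algebra.smul_def, hr]
  ring

theorem isInverseClass_mk (hB : B ≠ 0) {x z : K} (hx : x ∈ B) (hz : z ∈ B⁻¹)
    (hxz : x * z - 1 ∈ Q * B⁻¹) :
    IsInverseClass (Submodule.Quotient.mk ⟨x, hx⟩ : IdealQuotient B Q)
      (Submodule.Quotient.mk ⟨z, hz⟩) := by
  have hx' : x ∈ (B⁻¹)⁻¹ := by rwa [inv_inv]
  have hQ : Q * B⁻¹ ^ 2 * B = Q * B⁻¹ := by field_simp
  refine ⟨mk_mem_unitClasses_of_mul_sub_one_mem (inv_ne_zero hB) hz hx' ?_,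
    fun x' z' hxx' hzz' => ?_⟩
  · rwa [inv_inv, hQ, mul_comm z]
  · have hz'z : ((z' : K) - z) * x ∈ Q * B⁻¹ :=
      hQ ▸ FractionalIdeal.mul_mem_mul ((mk_eq_mk_iff z' ⟨z, hz⟩).1 hzz') hx
    have hx'x : ((x' : K) - x) * z' ∈ Q * B⁻¹ :=
      FractionalIdeal.mul_mem_mul ((mk_eq_mk_iff x' ⟨x, hx⟩).1 hxx') z'.2
    have hsum : (x' : K) * z' - 1 = x * z - 1 + ((x' - x) * z' + (z' - z) * x) := by ring
    rw [hsum]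
    exact Submodule.add_mem _ hxz (Submodule.add_mem _ hx'x hz'z)

theorem isInverseClass_invClass (hB : B ≠ 0) {X : IdealQuotient B Q}
    (hX : X ∈ unitClasses B Q) : IsInverseClass X (invClass X) := by
  have h := (existsUnique_inverseClass hB hX).exists
  rw [invClass, dif_pos h]
  exact h.choose_spec

theorem rep_mul_rep_invClass_sub_one_mem (hB : B ≠ 0) {X : IdealQuotient B Q}
    (hX : X ∈ unitClasses B Q) : rep X * rep (invClass X) - 1 ∈ Q * B⁻¹ :=
  (isInverseClass_invClass hB hX).2 ⟨_, rep_mem X⟩ ⟨_, rep_mem _⟩ (mk_rep _) (mk_rep _)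

theorem bijOn_invClass (hB : B ≠ 0) :
    Set.BijOn invClass (unitClasses B Q) (unitClasses B⁻¹ (Q * B⁻¹ ^ 2)) := by
  refine ⟨fun X hX => (isInverseClass_invClass hB hX).1, fun X hX X' hX' h => ?_, fun Z hZ => ?_⟩
  · have hz := rep_mul_rep_invClass_sub_one_mem hB hX
    have hz' := rep_mul_rep_invClass_sub_one_mem hB hX'
    rw [← h] at hz'
    rw [← mk_rep X, ← mk_rep X', mk_eq_mk_iff]
    have hdiff : rep X - rep X' = (rep X' * rep (invClass X) - 1) * -rep X +
        (rep X * rep (invClass X) - 1) * rep X' := by ring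
    change rep X - rep X' ∈ Q
    rw [hdiff]
    exact (inv_mul_cancel_right₀ hB Q).le <| Submodule.add_mem _
      (FractionalIdeal.mul_mem_mul hz' (Submodule.neg_mem _ (rep_mem X)))
      (FractionalIdeal.mul_mem_mul hz (rep_mem X'))
  · have hB' := inv_ne_zero hB
    set x := rep (invClass Z)
    have hx : x ∈ B := by simpa only [inv_inv] using rep_mem (invClass Z)
    have hzx := rep_mul_rep_invClass_sub_one_mem hB' hZ
    have hQ : Q * B⁻¹ ^ 2 * B⁻¹⁻¹ = Q * B⁻¹ := by rw [inv_inv]; field_simp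
    rw [hQ, mul_comm (rep Z)] at hzx
    have hX := mk_mem_unitClasses_of_mul_sub_one_mem hB hx (rep_mem Z) hzx
    refine ⟨_, hX, ?_⟩
    rw [(existsUnique_inverseClass hB hX).unique (isInverseClass_invClass hB hX)
      (isInverseClass_mk hB hx (rep_mem Z) hzx), mk_rep]

theorem torsionOf_mk_div {e : K} (he : ∀ x ∈ B, x / e ∈ (different K)⁻¹ ↔ x ∈ Q) {x : K}
    (hx : x ∈ B) :
    torsionOf (𝓞 K) (DualQuotient K) (Submodule.Quotient.mk (x / e)) =
      torsionOf (𝓞 K) (IdealQuotient B Q) (Submodule.Quotient.mk ⟨x, hx⟩) := by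
  ext u
  rw [Ideal.mem_torsionOf_iff, Ideal.mem_torsionOf_iff, ← Submodule.Quotient.mk_smul,
    ← Submodule.Quotient.mk_smul, dualQuotient_mk_eq_zero, ← smul_div_assoc,
    he _ (Submodule.smul_mem _ u hx), Submodule.Quotient.mk_eq_zero]
  rfl

/-- Division by `e` embeds `B / Q` into `K / 𝔇⁻¹`, and an embedding preserves annihilators. -/
theorem bijOn_mk_rep_div (hB : B ≠ 0) (hq : q ≠ ⊥) (hQ : B * (q : FracIdeal K) = Q) {e : K}
    (he : ∀ x ∈ B, x / e ∈ (different K)⁻¹ ↔ x ∈ Q)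
    (hsurj : ∀ y ∈ ((q : FracIdeal K) * different K)⁻¹, ∃ x ∈ B, x / e - y ∈ (different K)⁻¹) :
    Set.BijOn (fun X : IdealQuotient B Q =>
        (Submodule.Quotient.mk (rep X / e) : DualQuotient K))
      (unitClasses B Q) (primitiveFinset q) := by
  have hmem : ∀ X : IdealQuotient B Q, X ∈ unitClasses B Q ↔
      (Submodule.Quotient.mk (rep X / e) : DualQuotient K) ∈ primitiveFinset q := fun X => by
    rw [mem_unitClasses_iff_torsionOf_eq hB hq hQ, mem_primitiveFinset hq,
      torsionOf_mk_div he (rep_mem X), mk_rep]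
  have hinj : ∀ x (hx : x ∈ B) x' (hx' : x' ∈ B),
      (Submodule.Quotient.mk (x / e) : DualQuotient K) = Submodule.Quotient.mk (x' / e) ↔
        (Submodule.Quotient.mk ⟨x, hx⟩ : IdealQuotient B Q) = Submodule.Quotient.mk ⟨x', hx'⟩ :=
    fun x hx x' hx' => by
      rw [mk_eq_mk_iff, Submodule.Quotient.eq, ← sub_div]
      exact he _ (Submodule.sub_mem _ hx hx')
  refine ⟨fun X hX => (hmem X).1 hX, fun X _ X' _ h => ?_, fun Y hY => ?_⟩
  · rw [← mk_rep X, ← mk_rep X']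
    exact (hinj _ _ _ _).1 h
  · obtain ⟨y, rfl⟩ := Submodule.Quotient.mk_surjective _ Y
    have hyq := (mk_mem_dualTorsion_iff hq).1 <|
      mem_torsionBySet_iff_torsionOf_dvd.2 ((mem_primitiveFinset hq).1 hY).dvd
    obtain ⟨x, hx, hxy⟩ := hsurj y hyq
    have hX : (Submodule.Quotient.mk (rep (Submodule.Quotient.mk ⟨x, hx⟩ : IdealQuotient B Q) / e) :
        DualQuotient K) = Submodule.Quotient.mk y :=
      ((hinj _ (rep_mem _) x hx).2 (mk_rep _)).trans ((Submodule.Quotient.eq _).2 hxy)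
    exact ⟨_, (hmem _).2 (hX ▸ hY), hX⟩

end UnitClasses

section Kloosterman

open FractionalIdeal (count)

variable {K : Type*} [Field K] [NumberField K] {b q q₁ : Ideal (𝓞 K)} {δ x z : K}

theorem count_idealDiv (v : HeightOneSpectrum (𝓞 K)) (hq : q ≠ ⊥) (h : b ∣ q) :
    count K v (idealDiv q b) = count K v q - count K v b := by
  rw [eq_sub_iff_add_eq', ← count_coeIdeal_mul (ne_zero_of_dvd_ne_zero hq h)
    (idealDiv_ne_bot hq h), idealDiv_mul_cancel h]

theorem mem_mul_different_inv_iff (hq : q ≠ ⊥) :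
    x ∈ ((q : FracIdeal K) * different K)⁻¹ ↔
      ∀ v, OrdGe v (-(count K v q + count K v (different K))) x := by
  have hq' : (q : FracIdeal K) ≠ 0 := FractionalIdeal.coeIdeal_ne_zero.2 hq
  simp only [mem_iff_forall_ordGe (inv_ne_zero (mul_ne_zero hq' different_ne_zero)),
    FractionalIdeal.count_inv, FractionalIdeal.count_mul K _ hq' different_ne_zero]

open scoped Classical in
theorem mem_partAt_inv_iff (I : FracIdeal K) (hb : b ≠ ⊥) :
    x ∈ (partAt I b)⁻¹ ↔ ∀ v, OrdGe v (-if v.asIdeal ∣ b then count K v I else 0) x := by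
  simp only [mem_iff_forall_ordGe (inv_ne_zero (partAt_ne_zero I b)),
    FractionalIdeal.count_inv, count_partAt I hb]

open scoped Classical in
theorem mem_mul_partAt_iff (I : FracIdeal K) (hb : b ≠ ⊥) (hq : q ≠ ⊥) :
    x ∈ (q : FracIdeal K) * partAt I b ↔
      ∀ v, OrdGe v (count K v q + if v.asIdeal ∣ b then count K v I else 0) x := by
  have hq' : (q : FracIdeal K) ≠ 0 := FractionalIdeal.coeIdeal_ne_zero.2 hq
  simp only [mem_iff_forall_ordGe (mul_ne_zero hq' (partAt_ne_zero I b)),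
    FractionalIdeal.count_mul K _ hq' (partAt_ne_zero I b), count_partAt I hb]

open scoped Classical in
theorem mem_mul_partAt_inv_iff (I : FracIdeal K) (hb : b ≠ ⊥) (hq : q ≠ ⊥) :
    x ∈ ((q : FracIdeal K) * partAt I b)⁻¹ ↔
      ∀ v, OrdGe v (-(count K v q + if v.asIdeal ∣ b then count K v I else 0)) x := by
  have hq' : (q : FracIdeal K) ≠ 0 := FractionalIdeal.coeIdeal_ne_zero.2 hq
  simp only [mem_iff_forall_ordGe (inv_ne_zero (mul_ne_zero hq' (partAt_ne_zero I b))),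
    FractionalIdeal.count_inv, FractionalIdeal.count_mul K _ hq' (partAt_ne_zero I b),
    count_partAt I hb]

theorem mem_different_inv_iff_mem_partAt_inv (hb : b ≠ ⊥) (hq : q ∣ b)
    (hx : x ∈ ((q : FracIdeal K) * partAt (different K) b)⁻¹) :
    x ∈ (different K)⁻¹ ↔ x ∈ (partAt (different K) b)⁻¹ := by
  classical
  have hq0 := ne_zero_of_dvd_ne_zero hb hq
  rw [mem_mul_partAt_inv_iff _ hb hq0] at hx
  rw [mem_different_inv_iff_ordGe, mem_partAt_inv_iff _ hb]
  refine forall_congr' fun v => ?_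
  split_ifs with hv
  · rfl
  · have hxv : OrdGe v (-0) x := by
      simpa [hv, count_eq_zero_of_not_dvd hq0 fun h => hv (h.trans hq)] using hx v
    exact iff_of_true (hxv.mono (by simpa using neg_count_different_nonpos v)) hxv

theorem exists_mem_sub_mem_different_inv (hb : b ≠ ⊥) (hq : q ∣ b) {y : K}
    (hy : y ∈ ((q : FracIdeal K) * different K)⁻¹) :
    ∃ x ∈ ((q : FracIdeal K) * partAt (different K) b)⁻¹, x - y ∈ (different K)⁻¹ := by
  classical
  have hq0 := ne_zero_of_dvd_ne_zero hb hq
  rw [mem_mul_different_inv_iff hq0] at hy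
  obtain ⟨x, hxS, hx⟩ :=
    exists_ordGe_sub_and_ordGe {v | v.asIdeal ∣ b} (partAt (different K) b)⁻¹ y
  simp only [Set.mem_ofPred_eq, FractionalIdeal.count_inv, count_partAt _ hb] at hxS hx
  refine ⟨x, (mem_mul_partAt_inv_iff _ hb hq0).2 fun v => ?_,
    mem_different_inv_iff_ordGe.2 fun v => ?_⟩
  all_goals
    have hqv := FractionalIdeal.count_coe_nonneg K v q
    have hDv := neg_count_different_nonpos v
    by_cases hv : v.asIdeal ∣ b
  · have hsub := hxS v hv
    rw [if_pos hv] at hsub ⊢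
    simpa using (hsub.mono (by linarith)).add (hy v)
  · exact (hx v hv).mono (by rw [if_neg hv]; linarith)
  · simpa only [if_pos hv] using hxS v hv
  · have hyv := hy v
    rw [count_eq_zero_of_not_dvd hq0 fun h => hv (h.trans hq), zero_add] at hyv
    exact ((hx v hv).mono (by rw [if_neg hv]; linarith)).sub hyv

theorem bijOn_mk_rep (hb : b ≠ ⊥) (hq : q ∣ b) :
    Set.BijOn (fun X : IdealQuotient ((q : FracIdeal K) * partAt (different K) b)⁻¹
        (partAt (different K) b)⁻¹ => (Submodule.Quotient.mk (rep X) : DualQuotient K))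
      (unitClasses ((q : FracIdeal K) * partAt (different K) b)⁻¹ (partAt (different K) b)⁻¹)
      (primitiveFinset q) := by
  have hq0 := ne_zero_of_dvd_ne_zero hb hq
  have hq' : (q : FracIdeal K) ≠ 0 := FractionalIdeal.coeIdeal_ne_zero.2 hq0
  have hQ : ((q : FracIdeal K) * partAt (different K) b)⁻¹ * (q : FracIdeal K) =
      (partAt (different K) b)⁻¹ := by
    rw [mul_inv, mul_right_comm, inv_mul_cancel₀ hq', one_mul]
  simpa only [div_one] using bijOn_mk_rep_div
    (inv_ne_zero (mul_ne_zero hq' (partAt_ne_zero _ _))) hq0 hQ (e := 1)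
    (fun x hx => by rw [div_one, mem_different_inv_iff_mem_partAt_inv hb hq hx])
    (fun y hy => by simpa only [div_one] using exists_mem_sub_mem_different_inv hb hq hy)

theorem psiIdeal_add_mul_eq (hb : b ≠ ⊥) (hq : q ≠ ⊥) (hx : ∀ v, ¬ v.asIdeal ∣ b → OrdGe v 0 x)
    {w : 𝓞 K} (hw : ∀ v, ¬ v.asIdeal ∣ b → OrdGe v (count K v q) (algebraMap (𝓞 K) K w))
    (hwz : ∀ v, v.asIdeal ∣ b → OrdGe v (count K v q) (algebraMap (𝓞 K) K w - δ * z))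
    {y : K} (hy : y ∈ ((q : FracIdeal K) * different K)⁻¹) :
    psiIdeal b (x + -(δ * y) * z) =
      traceChar K x * traceChar K (-(algebraMap (𝓞 K) K w * y)) := by
  rw [mem_mul_different_inv_iff hq] at hy
  have hsplit : x + -(δ * y) * z = x + -(algebraMap (𝓞 K) K w * y) +
      (algebraMap (𝓞 K) K w - δ * z) * y := by ring
  rw [hsplit, psiIdeal_add hb, psiIdeal_add hb,
    psiIdeal_eq_one (x := (algebraMap (𝓞 K) K w - δ * z) * y) fun v hv =>
      ((hwz v hv).mul (hy v)).mono (by linarith), mul_one,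
    psiIdeal_eq_traceChar fun v hv => (hx v hv).mono (neg_count_different_nonpos v),
    psiIdeal_eq_traceChar fun v hv =>
      ordGe_neg_iff.2 (((hw v hv).mul (hy v)).mono (by linarith))]

theorem exists_mem_idealDiv_and_psiIdeal_eq (hb : b ≠ ⊥) (hq : q ≠ ⊥) (hbq : b ∣ q) (hq₁ : q₁ ∣ b)
    (hδ : ∀ v, v.asIdeal ∣ b →
      OrdGe v (count K v q - 2 * count K v q₁ - count K v (different K)) δ)
    (hx : x ∈ ((q₁ : FracIdeal K) * partAt (different K) b)⁻¹)
    (hz : z ∈ (q₁ : FracIdeal K) * partAt (different K) b)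
    (hxz : x * z - 1 ∈ (q₁ : FracIdeal K)) :
    ∃ w ∈ idealDiv q q₁,
      (∀ v, v.asIdeal ∣ b → OrdGe v (count K v q - count K v q₁ - count K v (different K))
        (algebraMap (𝓞 K) K w * x - δ)) ∧
      ∀ y ∈ ((q : FracIdeal K) * different K)⁻¹, psiIdeal b (x + -(δ * y) * z) =
        traceChar K x * traceChar K (-(algebraMap (𝓞 K) K w * y)) := by
  classical
  have hq₁0 := ne_zero_of_dvd_ne_zero hb hq₁
  have hq₁q := hq₁.trans hbq
  rw [mem_mul_partAt_inv_iff _ hb hq₁0] at hx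
  rw [mem_mul_partAt_iff _ hb hq₁0] at hz
  rw [mem_coeIdeal_iff_forall_ordGe hq₁0] at hxz
  have hnn := fun v => FractionalIdeal.count_coe_nonneg K v q₁
  obtain ⟨w₀, hwS, hw⟩ := exists_ordGe_sub_and_ordGe {v | v.asIdeal ∣ b} (q : FracIdeal K) (δ * z)
  have hmem : w₀ ∈ (idealDiv q q₁ : FracIdeal K) := by
    rw [mem_coeIdeal_iff_forall_ordGe (idealDiv_ne_bot hq hq₁q)]
    intro v
    rw [count_idealDiv v hq hq₁q]
    by_cases hv : v.asIdeal ∣ b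
    · have hzv := hz v
      rw [if_pos hv] at hzv
      simpa using ((hwS v hv).mono (by linarith [hnn v])).add
        (((hδ v hv).mul hzv).mono (n := _) (by linarith))
    · exact (hw v hv).mono (by linarith [hnn v])
  obtain ⟨w, hwq, rfl⟩ := (FractionalIdeal.mem_coeIdeal _).1 hmem
  refine ⟨w, hwq, fun v hv => ?_, fun y hy => psiIdeal_add_mul_eq hb hq (fun v hv => ?_) hw hwS hy⟩
  · have hxv := hx v
    rw [if_pos hv] at hxv
    have hsplit : algebraMap (𝓞 K) K w * x - δ =
        (algebraMap (𝓞 K) K w - δ * z) * x + δ * (x * z - 1) := by ring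
    rw [hsplit]
    exact (((hwS v hv).mul hxv).mono (by linarith)).add
      (((hδ v hv).mul (hxz v)).mono (by linarith))
  · simpa [hv, count_eq_zero_of_not_dvd hq₁0 fun h => hv (h.trans hq₁)] using hx v

theorem exists_kloosterman_eq (hb : b ≠ ⊥) (hq : q ≠ ⊥) (hbq : b ∣ q) (hq₁ : q₁ ∣ b)
    (hδ : ∀ v, v.asIdeal ∣ b →
      OrdGe v (count K v q - 2 * count K v q₁ - count K v (different K)) δ) :
    ∃ w : DualQuotient K → 𝓞 K,
      (∀ X ∈ primitiveFinset q₁, w X ∈ idealDiv q q₁ ∧ ∃ x : K, Submodule.Quotient.mk x = X ∧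
        ∀ v, v.asIdeal ∣ b → OrdGe v (count K v q - count K v q₁ - count K v (different K))
          (algebraMap (𝓞 K) K (w X) * x - δ)) ∧
      ∀ y ∈ ((q : FracIdeal K) * different K)⁻¹, kloosterman b 1 (-(δ * y)) q₁ =
        ∑ X ∈ primitiveFinset q₁,
          quotChar K X * quotChar K (-(w X • (Submodule.Quotient.mk y : DualQuotient K))) := by
  have hB : ((q₁ : FracIdeal K) * partAt (different K) b)⁻¹ ≠ 0 := inv_ne_zero <|
    mul_ne_zero (FractionalIdeal.coeIdeal_ne_zero.2 (ne_zero_of_dvd_ne_zero hb hq₁))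
      (partAt_ne_zero _ _)
  have hQ : (partAt (different K) b)⁻¹ * ((q₁ : FracIdeal K) * partAt (different K) b)⁻¹⁻¹ =
      q₁ := by
    rw [inv_inv, mul_left_comm, inv_mul_cancel₀ (partAt_ne_zero _ _), mul_one]
  have hbij := bijOn_mk_rep (K := K) hb hq₁
  have hmul := fun X hX => exists_mem_idealDiv_and_psiIdeal_eq hb hq hbq hq₁ hδ (rep_mem X)
    (by simpa only [inv_inv] using rep_mem (invClass X))
    (hQ ▸ rep_mul_rep_invClass_sub_one_mem hB hX)
  choose! w hwq hwδ hwψ using hmul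
  obtain ⟨g, hinv, hmaps⟩ : ∃ g, Set.InvOn g
      (fun X : IdealQuotient ((q₁ : FracIdeal K) * partAt (different K) b)⁻¹
        (partAt (different K) b)⁻¹ => (Submodule.Quotient.mk (rep X) : DualQuotient K))
      (unitClasses _ _) (primitiveFinset q₁) ∧
      Set.MapsTo g (primitiveFinset q₁) (unitClasses _ _) :=
    ⟨_, hbij.invOn_invFunOn, hbij.surjOn.mapsTo_invFunOn⟩
  refine ⟨w ∘ g, fun Y hY => ?_, fun y hy => ?_⟩
  · exact ⟨hwq _ (hmaps hY), _, hinv.2 hY, hwδ _ (hmaps hY)⟩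
  · rw [kloosterman, finsum_mem_eq_of_bijOn _ hbij, finsum_mem_coe_finset]
    intro X hX
    rw [Function.comp_apply, hinv.1 hX, one_mul, hwψ X hX y hy, quotChar_mk,
      ← Submodule.Quotient.mk_smul, ← Submodule.Quotient.mk_neg, quotChar_mk, Algebra.smul_def]

end Kloosterman

section RamanujanSum

open Ideal (torsionOf)

theorem one_add_notMem {R : Type*} [Ring R] {I : Ideal R} {w : R} (hI : I ≠ ⊤) (hw : w ∈ I) :
    1 + w ∉ I := fun h =>
  (Ideal.ne_top_iff_one I).1 hI ((Submodule.add_mem_iff_left _ hw).1 h)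

variable {K : Type*} [Field K] [NumberField K] {a b q q₁ g : Ideal (𝓞 K)} {u w : 𝓞 K}
  {v : HeightOneSpectrum (𝓞 K)}

/-- The Ramanujan sum `c_q(u)` of the number field `K`, with the elements of `K / 𝔇⁻¹` of exact
annihilator `q` in the role of the primitive `q`-th roots of unity. -/
def ramanujanSum (q : Ideal (𝓞 K)) (u : 𝓞 K) : ℂ :=
  ∑ Y ∈ primitiveFinset q, quotChar K (u • Y)

open scoped Classical in
theorem ramanujanSum_eq_sum_idealDivisors (hq : q ≠ ⊥) (u : 𝓞 K) :
    ramanujanSum q u =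
      ∑ k ∈ idealDivisors q with u ∈ k, (idealMoebius (idealDiv q k) : ℂ) * Ideal.absNorm k := by
  rw [ramanujanSum, sum_primitiveFinset hq, Finset.sum_filter]
  refine Finset.sum_congr rfl fun k hk => ?_
  rw [sum_quotChar_smul (ne_zero_of_dvd_ne_zero hq ((mem_idealDivisors hq).1 hk)), mul_ite,
    mul_zero]

theorem ramanujanSum_neg (hq : q ≠ ⊥) (u : 𝓞 K) : ramanujanSum q (-u) = ramanujanSum q u := by
  classical
  simp only [ramanujanSum_eq_sum_idealDivisors hq, neg_mem_iff]

theorem ramanujanSum_eq_zero_of_sq_dvd (hq : q ≠ ⊥) (hv : v.asIdeal ^ 2 ∣ q)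
    (hu : u ∉ v.asIdeal) : ramanujanSum q u = 0 := by
  classical
  rw [ramanujanSum_eq_sum_idealDivisors hq]
  refine Finset.sum_eq_zero fun k hk => ?_
  obtain ⟨hkq, huk⟩ := Finset.mem_filter.1 hk
  rw [mem_idealDivisors hq] at hkq
  have hvk : IsCoprime v.asIdeal k :=
    isCoprime_of_prime_of_not_dvd v.prime fun h => hu (Ideal.dvd_iff_le.1 h huk)
  rw [← idealDiv_mul_cancel hkq] at hv
  rw [idealMoebius_eq_zero_of_sq_dvd v.prime (hvk.pow_left.dvd_of_dvd_mul_left hv), Int.cast_zero,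
    zero_mul]

theorem ramanujanSum_mul_of_isCoprime (ha : a ≠ ⊥) (hb : b ≠ ⊥) (hab : IsCoprime a b)
    (hu : ∀ v : HeightOneSpectrum (𝓞 K), v.asIdeal ∣ b → u ∉ v.asIdeal) :
    ramanujanSum (a * b) u = ramanujanSum a u * idealMoebius b := by
  classical
  have hab0 : a * b ≠ ⊥ := mul_ne_zero ha hb
  rw [ramanujanSum_eq_sum_idealDivisors hab0, ramanujanSum_eq_sum_idealDivisors ha, Finset.sum_mul]
  have hdiv : ∀ k, u ∈ k → (k ∣ a * b ↔ k ∣ a) := fun k huk =>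
    ⟨fun hk => ((isCoprime_iff_forall_not_dvd hb).2 fun v hvb hvk =>
      hu v hvb (Ideal.dvd_iff_le.1 hvk huk)).symm.dvd_of_dvd_mul_right hk,
      fun hk => hk.mul_right b⟩
  refine Finset.sum_congr (Finset.ext fun k => ?_) fun k hk => ?_
  · simp only [Finset.mem_filter, mem_idealDivisors hab0, mem_idealDivisors ha]
    exact and_congr_left (hdiv k)
  · rw [Finset.mem_filter, mem_idealDivisors ha] at hk
    have hdivk : idealDiv (a * b) k = idealDiv a k * b :=
      idealDiv_eq_of_mul_eq (ne_zero_of_dvd_ne_zero ha hk.1)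
        (by rw [← mul_assoc, idealDiv_mul_cancel hk.1])
    rw [hdivk, idealMoebius_mul (hab.of_isCoprime_of_dvd_left (idealDiv_dvd hk.1)), Int.cast_mul,
      mul_right_comm]

theorem ramanujanSum_one_add_eq_zero (hq : q ≠ ⊥) (hq₁ : q₁ ∣ q)
    (hcop : ¬ IsCoprime q₁ (idealDiv q q₁)) (hw : w ∈ idealDiv q q₁) :
    ramanujanSum q (1 + w) = 0 := by
  rw [isCoprime_iff_forall_not_dvd (ne_zero_of_dvd_ne_zero hq hq₁)] at hcop
  push Not at hcop
  obtain ⟨v, hv₁, hv⟩ := hcop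
  refine ramanujanSum_eq_zero_of_sq_dvd hq ?_
    (one_add_notMem v.isPrime.ne_top (Ideal.dvd_iff_le.1 hv hw))
  rw [sq, ← idealDiv_mul_cancel hq₁]
  exact mul_dvd_mul hv₁ hv

theorem ramanujanSum_one_add_eq (hq : q ≠ ⊥) (hq₁ : q₁ ∣ q)
    (hcop : IsCoprime q₁ (idealDiv q q₁)) (hw : w ∈ idealDiv q q₁) :
    ramanujanSum q (1 + w) = ramanujanSum q₁ (1 + w) * idealMoebius (idealDiv q q₁) := by
  rw [← ramanujanSum_mul_of_isCoprime (ne_zero_of_dvd_ne_zero hq hq₁) (idealDiv_ne_bot hq hq₁)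
    hcop fun v hv => one_add_notMem v.isPrime.ne_top (Ideal.dvd_iff_le.1 hv hw),
    idealDiv_mul_cancel hq₁]

theorem add_smul_mem_dualTorsion_iff {X : DualQuotient K} (hq : q ≠ ⊥) (hg : g ∣ q)
    (hX : torsionOf (𝓞 K) (DualQuotient K) X = q) :
    X + w • X ∈ dualTorsion K (idealDiv q g) ↔ 1 + w ∈ g := by
  have hsmul : X + w • X = (1 + w) • X := by rw [add_smul, one_smul]
  rw [hsmul, Submodule.mem_torsionBySet_iff, ← Ideal.span_singleton_le_iff_mem,
    ← Ideal.dvd_iff_le, ← mul_dvd_mul_iff_right (idealDiv_ne_bot hq hg), idealDiv_mul_cancel hg,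
    Ideal.dvd_iff_le, Ideal.span_singleton_mul_le_iff]
  simp only [Subtype.forall, SetLike.mem_coe, smul_smul]
  refine forall₂_congr fun x _ => ?_
  rw [← Ideal.mem_torsionOf_iff, hX, mul_comm]

open scoped Classical in
theorem ramanujanSum_one_add_eq_sum {X : DualQuotient K} (hq : q ≠ ⊥)
    (hX : torsionOf (𝓞 K) (DualQuotient K) X = q) :
    ramanujanSum q (1 + w) = ∑ f ∈ idealDivisors q with X + w • X ∈ dualTorsion K f,
      (idealMoebius f : ℂ) * Ideal.absNorm (idealDiv q f) := by
  rw [ramanujanSum_eq_sum_idealDivisors hq, Finset.sum_filter, Finset.sum_filter,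
    ← sum_idealDivisors_idealDiv]
  refine Finset.sum_congr rfl fun f hf => ?_
  rw [mem_idealDivisors hq] at hf
  rw [← add_smul_mem_dualTorsion_iff hq (idealDiv_dvd hf) hX, idealDiv_idealDiv hq hf]

open scoped Classical in
theorem sum_quotChar_mul_ramanujanSum_one_add {Δ : DualQuotient K} {w : DualQuotient K → 𝓞 K}
    (hq : q ≠ ⊥) (hw : ∀ X ∈ primitiveFinset q, w X • X = Δ) :
    ∑ X ∈ primitiveFinset q, quotChar K X * ramanujanSum q (1 + w X) =
      ∑ p ∈ idealDivisors q ×ˢ idealDivisors q, (idealMoebius (idealDiv q p.1) : ℂ) *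
        ((idealMoebius p.2 : ℂ) * Ideal.absNorm (idealDiv q p.2)) *
          ∑ X ∈ dualTorsionFinset p.1 with X + Δ ∈ dualTorsion K p.2, quotChar K X := by
  have hinner : ∀ X ∈ primitiveFinset q, quotChar K X * ramanujanSum q (1 + w X) =
      ∑ f ∈ idealDivisors q, (idealMoebius f : ℂ) * Ideal.absNorm (idealDiv q f) *
        if X + Δ ∈ dualTorsion K f then quotChar K X else 0 := fun X hX => by
    rw [ramanujanSum_one_add_eq_sum hq ((mem_primitiveFinset hq).1 hX), hw X hX, Finset.sum_filter,
      Finset.mul_sum]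
    exact Finset.sum_congr rfl fun f _ => by split_ifs <;> ring
  rw [Finset.sum_congr rfl hinner, sum_primitiveFinset hq, Finset.sum_product]
  refine Finset.sum_congr rfl fun k _ => ?_
  rw [Finset.sum_comm, Finset.mul_sum]
  refine Finset.sum_congr rfl fun f _ => ?_
  rw [← Finset.mul_sum, ← Finset.sum_filter, ← mul_assoc]

end RamanujanSum

section LocalEvaluation

open FractionalIdeal (count)

variable {K : Type*} [Field K] [NumberField K] {q k f t : Ideal (𝓞 K)} {δ d x : K} {w : 𝓞 K}

theorem mk_mem_dualTorsion_iff_ordGe (hk : k ≠ ⊥) :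
    (Submodule.Quotient.mk x : DualQuotient K) ∈ dualTorsion K k ↔
      ∀ v, OrdGe v (-(count K v k + count K v (different K))) x := by
  rw [mk_mem_dualTorsion_iff hk, mem_mul_different_inv_iff hk]

theorem ordGe_of_mk_mem_dualTorsion (hk : k ≠ ⊥)
    (hx : (Submodule.Quotient.mk x : DualQuotient K) ∈ dualTorsion K k)
    {v : HeightOneSpectrum (𝓞 K)} (hv : ¬ v.asIdeal ∣ k) :
    OrdGe v (-count K v (different K)) x := by
  simpa [count_eq_zero_of_not_dvd hk hv] using (mk_mem_dualTorsion_iff_ordGe hk).1 hx v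

/-- The class of `d` in `K / 𝔇⁻¹` is the component of the class of `δ` supported at the primes
dividing `q`. -/
structure IsLocalPart (q : Ideal (𝓞 K)) (δ d : K) : Prop where
  ordGe_sub : ∀ v : HeightOneSpectrum (𝓞 K), v.asIdeal ∣ q →
    OrdGe v (-count K v (different K)) (d - δ)
  ordGe : ∀ v : HeightOneSpectrum (𝓞 K), ¬ v.asIdeal ∣ q → OrdGe v (-count K v (different K)) d

theorem exists_isLocalPart (q : Ideal (𝓞 K)) (δ : K) : ∃ d, IsLocalPart q δ d := by
  obtain ⟨d, hsub, hd⟩ := exists_ordGe_sub_and_ordGe {v | v.asIdeal ∣ q} (different K)⁻¹ δ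
  simp only [FractionalIdeal.count_inv] at hsub hd
  exact ⟨d, hsub, hd⟩

namespace IsLocalPart

theorem smul_mk_eq (hd : IsLocalPart q δ d) (hq : q ≠ ⊥)
    (hx : (Submodule.Quotient.mk x : DualQuotient K) ∈ dualTorsion K q)
    (hw : ∀ v : HeightOneSpectrum (𝓞 K), v.asIdeal ∣ q →
      OrdGe v (-count K v (different K)) (algebraMap (𝓞 K) K w * x - δ)) :
    w • (Submodule.Quotient.mk x : DualQuotient K) = Submodule.Quotient.mk d := by
  rw [← Submodule.Quotient.mk_smul, Submodule.Quotient.eq, Algebra.smul_def]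
  refine mem_different_inv_iff_ordGe.2 fun v => ?_
  by_cases hv : v.asIdeal ∣ q
  · simpa only [sub_sub_sub_cancel_right] using (hw v hv).sub (hd.ordGe_sub v hv)
  · have hwx := (ordGe_algebraMap v w).mul (ordGe_of_mk_mem_dualTorsion hq hx hv)
    exact (hwx.mono (zero_add _).ge).sub (hd.ordGe v hv)

theorem mk_mem_dualTorsion_iff (hd : IsLocalPart q δ d) (hq : q ≠ ⊥) (ht : t ∣ q) :
    (Submodule.Quotient.mk d : DualQuotient K) ∈ dualTorsion K t ↔
      ∀ v : HeightOneSpectrum (𝓞 K), v.asIdeal ∣ q →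
        OrdGe v (-(count K v t + count K v (different K))) δ := by
  have hle : ∀ v : HeightOneSpectrum (𝓞 K),
      -(count K v t + count K v (different K)) ≤ -count K v (different K) := fun v => by
    linarith [FractionalIdeal.count_coe_nonneg K v t]
  rw [mk_mem_dualTorsion_iff_ordGe (ne_zero_of_dvd_ne_zero hq ht)]
  refine ⟨fun h v hv => ?_, fun h v => ?_⟩
  · simpa using (h v).sub ((hd.ordGe_sub v hv).mono (hle v))
  · by_cases hv : v.asIdeal ∣ q
    · simpa using ((hd.ordGe_sub v hv).mono (hle v)).add (h v hv)
    · exact (hd.ordGe v hv).mono (hle v)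

theorem quotChar_mk_eq (hd : IsLocalPart q δ d) (hq : q ≠ ⊥) (hk : k ∣ q) (hf : f ∣ q)
    (hkf : IsCoprime k f) (hx : (Submodule.Quotient.mk x : DualQuotient K) ∈ dualTorsion K k)
    (hxd : (Submodule.Quotient.mk (x + d) : DualQuotient K) ∈ dualTorsion K f) :
    quotChar K (Submodule.Quotient.mk x) = psiIdeal q (-δ) * psiIdeal f δ := by
  have hk0 := ne_zero_of_dvd_ne_zero hq hk
  have hf0 := ne_zero_of_dvd_ne_zero hq hf
  have hxv := fun v => ordGe_of_mk_mem_dualTorsion hk0 hx (v := v)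
  have hxδ : psiIdeal q (x + δ) = psiIdeal f (x + δ) := psiIdeal_eq_of_dvd hf fun v hv hvf => by
    simpa [add_sub_assoc] using
      (ordGe_of_mk_mem_dualTorsion hf0 hxd hvf).sub (hd.ordGe_sub v hv)
  have hfx : psiIdeal f x = 1 := psiIdeal_eq_one fun v hvf =>
    hxv v fun hvk => (isCoprime_iff_forall_not_dvd hk0).1 hkf v hvk hvf
  calc quotChar K (Submodule.Quotient.mk x) = psiIdeal q x := by
        rw [quotChar_mk, psiIdeal_eq_traceChar fun v hv => hxv v fun h => hv (h.trans hk)]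
    _ = psiIdeal q (-δ) * psiIdeal q (x + δ) := by
        rw [← psiIdeal_add hq, neg_add_eq_sub, add_sub_cancel_right]
    _ = psiIdeal q (-δ) * psiIdeal f δ := by rw [hxδ, psiIdeal_add hf0, hfx, one_mul]

open scoped Classical in
theorem sum_quotChar_filter_eq (hd : IsLocalPart q δ d) (hq : q ≠ ⊥) (hk : k ∣ q) (hf : f ∣ q) :
    ∑ X ∈ dualTorsionFinset k with X + Submodule.Quotient.mk d ∈ dualTorsion K f, quotChar K X =
      if IsCoprime k f ∧ ∀ v : HeightOneSpectrum (𝓞 K), v.asIdeal ∣ q →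
        OrdGe v (-(count K v (k * f : Ideal (𝓞 K)) + count K v (different K))) δ
      then psiIdeal q (-δ) * psiIdeal f δ else 0 := by
  have hk0 := ne_zero_of_dvd_ne_zero hq hk
  split_ifs with h
  · have hmem := (hd.mk_mem_dualTorsion_iff hq (h.1.mul_dvd hk hf)).2 h.2
    obtain ⟨X, hX, Y, hY, hXY⟩ :=
      Submodule.mem_sup.1 ((torsionBySet_sup_eq_torsionBySet_mul h.1).ge hmem)
    obtain ⟨x, rfl⟩ := Submodule.Quotient.mk_surjective _ X
    have hxd : (Submodule.Quotient.mk (-x + d) : DualQuotient K) ∈ dualTorsion K f := by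
      rwa [Submodule.Quotient.mk_add, ← hXY, Submodule.Quotient.mk_neg, neg_add_cancel_left]
    have hx := Submodule.neg_mem _ hX
    rw [← Submodule.Quotient.mk_neg] at hx
    rw [sum_quotChar_filter_add_mem_eq hk0 h.1 hx hxd, hd.quotChar_mk_eq hq hk hf h.1 hx hxd]
  · refine sum_quotChar_filter_add_mem_eq_zero hk0 fun hkf => h ⟨hkf.1, ?_⟩
    exact (hd.mk_mem_dualTorsion_iff hq (hkf.1.mul_dvd hk hf)).1 hkf.2

open scoped Classical in
theorem sum_quotChar_mul_ramanujanSum {w : DualQuotient K → 𝓞 K}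
    (hd : IsLocalPart q δ d) (hq : q ≠ ⊥)
    (hw : ∀ X ∈ primitiveFinset q, w X • X = Submodule.Quotient.mk d) :
    ∑ X ∈ primitiveFinset q, quotChar K X * ramanujanSum q (1 + w X) =
      psiIdeal q (-δ) * Ideal.absNorm q *
        ∑ p ∈ idealDivisors q ×ˢ idealDivisors q with IsCoprime p.1 p.2 ∧
          ∀ v : HeightOneSpectrum (𝓞 K), v.asIdeal ∣ q →
            OrdGe v (-(count K v (p.1 * p.2 : Ideal (𝓞 K)) + count K v (different K))) δ,
        (idealMoebius (idealDiv q p.1) : ℂ) * idealMoebius p.2 / Ideal.absNorm p.2 *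
          psiIdeal p.2 δ := by
  rw [sum_quotChar_mul_ramanujanSum_one_add hq hw, Finset.sum_filter, Finset.mul_sum]
  refine Finset.sum_congr rfl fun p hp => ?_
  rw [Finset.mem_product, mem_idealDivisors hq, mem_idealDivisors hq] at hp
  rw [hd.sum_quotChar_filter_eq hq hp.1 hp.2, absNorm_idealDiv hq hp.2]
  split_ifs <;> ring

end IsLocalPart

end LocalEvaluation

section ExponentialSum

open FractionalIdeal (count spanSingleton)

variable {K : Type*} [Field K] [NumberField K]

theorem div_mem_iff_mem_spanSingleton_mul {I : FracIdeal K} {e x : K} (he : e ≠ 0) :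
    x / e ∈ I ↔ x ∈ spanSingleton (𝓞 K)⁰ e * I := by
  rw [FractionalIdeal.mem_singleton_mul]
  exact ⟨fun h => ⟨x / e, h, (mul_div_cancel₀ x he).symm⟩, fun ⟨y, hy, hxy⟩ => by
    rwa [hxy, mul_div_cancel_left₀ y he]⟩

theorem bijOn_mk_rep_invClass_div {B : FracIdeal K} {q : Ideal (𝓞 K)} {e : K} (hB : B ≠ 0)
    (hq : q ≠ ⊥) (he : spanSingleton (𝓞 K)⁰ e = B⁻¹ * q * different K) :
    Set.BijOn (fun X : IdealQuotient B (B * (q : FracIdeal K)) =>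
        (Submodule.Quotient.mk (rep (invClass X) / e) : DualQuotient K))
      (unitClasses B (B * (q : FracIdeal K))) (primitiveFinset q) := by
  have hq' : (q : FracIdeal K) ≠ 0 := FractionalIdeal.coeIdeal_ne_zero.2 hq
  have hD := different_ne_zero (K := K)
  have he0 : e ≠ 0 := by
    rw [← FractionalIdeal.spanSingleton_ne_zero_iff (S := (𝓞 K)⁰), he]
    exact mul_ne_zero (mul_ne_zero (inv_ne_zero hB) hq') hD
  have hQ : B⁻¹ * (q : FracIdeal K) = B * q * B⁻¹ ^ 2 := by field_simp
  have heD : spanSingleton (𝓞 K)⁰ e * (different K)⁻¹ = B * q * B⁻¹ ^ 2 := by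
    rw [he, mul_assoc, mul_inv_cancel₀ hD, mul_one, hQ]
  have heB : spanSingleton (𝓞 K)⁰ e * ((q : FracIdeal K) * different K)⁻¹ = B⁻¹ := by
    rw [he]; field_simp
  refine (bijOn_mk_rep_div (inv_ne_zero hB) hq hQ (fun x _ => ?_) fun y hy => ?_).comp
    (bijOn_invClass hB)
  · rw [div_mem_iff_mem_spanSingleton_mul he0, heD]
  · refine ⟨e * y, ?_, ?_⟩
    · rwa [← heB, ← div_mem_iff_mem_spanSingleton_mul he0, mul_div_cancel_left₀ y he0]
    · rw [mul_div_cancel_left₀ y he0, sub_self]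
      exact Submodule.zero_mem _

variable {𝔞 𝔠 : FracIdeal K} {𝔡 𝔮 𝔮₁ t : Ideal (𝓞 K)} {β c γ : K} {v : HeightOneSpectrum (𝓞 K)}

theorem sup_mul_modulus : (𝔡 ⊔ 𝔮) * modulus 𝔡 𝔮 = 𝔮 :=
  idealDiv_mul_cancel (Ideal.dvd_iff_le.2 le_sup_right)

theorem modulus_dvd : modulus 𝔡 𝔮 ∣ 𝔮 :=
  Dvd.intro_left _ sup_mul_modulus

theorem isCoprime_idealDiv_sup_modulus (h𝔮 : 𝔮 ≠ ⊥) :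
    IsCoprime (idealDiv 𝔡 (𝔡 ⊔ 𝔮)) (modulus 𝔡 𝔮) := by
  have hsup : 𝔡 ⊔ 𝔮 ≠ ⊥ := ne_bot_of_le_ne_bot h𝔮 le_sup_right
  rw [Ideal.isCoprime_iff_sup_eq, ← Ideal.one_eq_top]
  refine mul_left_cancel₀ hsup ?_
  rw [Ideal.mul_sup, sup_mul_modulus, idealDiv_mul_cancel (Ideal.dvd_iff_le.2 le_sup_left),
    mul_one]

theorem count_eq_of_dvd_modulus (h𝔡 : 𝔡 ≠ ⊥) (h𝔮 : 𝔮 ≠ ⊥) (hv : v.asIdeal ∣ modulus 𝔡 𝔮) :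
    count K v 𝔮 = count K v 𝔡 + count K v (modulus 𝔡 𝔮) := by
  have hsup𝔡 : 𝔡 ⊔ 𝔮 ∣ 𝔡 := Ideal.dvd_iff_le.2 le_sup_left
  have hdiv := count_idealDiv (K := K) v h𝔡 hsup𝔡
  rw [count_eq_zero_of_not_dvd (idealDiv_ne_bot h𝔡 hsup𝔡) fun h =>
    (isCoprime_iff_forall_not_dvd (idealDiv_ne_bot h𝔡 hsup𝔡)).1
      (isCoprime_idealDiv_sup_modulus h𝔮) v h hv] at hdiv
  rw [sub_eq_zero.1 hdiv.symm, ← count_coeIdeal_mul (ne_zero_of_dvd_ne_zero h𝔡 hsup𝔡)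
    (ne_zero_of_dvd_ne_zero h𝔮 modulus_dvd), sup_mul_modulus]

theorem mem_mul_inv_iff_forall_ordGe (h𝔞 : 𝔞 ≠ 0) (h𝔠 : 𝔠 ≠ 0) (h𝔡 : 𝔡 ≠ ⊥) (h𝔮 : 𝔮 ≠ ⊥)
    (hβ : spanSingleton (𝓞 K)⁰ β = (𝔠 * different K) ^ 2 * (𝔞 * (𝔡 : FracIdeal K))⁻¹)
    (hc : spanSingleton (𝓞 K)⁰ c = 𝔠⁻¹ * (𝔮 : FracIdeal K)) (ht : t ≠ ⊥) :
    γ ∈ 𝔞 * ((t : FracIdeal K) * different K ^ 3)⁻¹ ↔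
      ∀ v, OrdGe v (2 * count K v 𝔮 - count K v 𝔡 - count K v t - count K v (different K))
        (β * c ^ 2 * γ) := by
  have hD := different_ne_zero (K := K)
  have h𝔡' : (𝔡 : FracIdeal K) ≠ 0 := FractionalIdeal.coeIdeal_ne_zero.2 h𝔡
  have h𝔮' : (𝔮 : FracIdeal K) ≠ 0 := FractionalIdeal.coeIdeal_ne_zero.2 h𝔮
  have ht' : (t : FracIdeal K) ≠ 0 := FractionalIdeal.coeIdeal_ne_zero.2 ht
  have hspan : spanSingleton (𝓞 K)⁰ (β * c ^ 2) =
      𝔮 ^ 2 * (𝔞 * (𝔡 : FracIdeal K))⁻¹ * different K ^ 2 := by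
    rw [← FractionalIdeal.spanSingleton_mul_spanSingleton, ← FractionalIdeal.spanSingleton_pow, hβ,
      hc]
    field_simp
  have he : β * c ^ 2 ≠ 0 := by
    rw [← FractionalIdeal.spanSingleton_ne_zero_iff (S := (𝓞 K)⁰), hspan]
    positivity
  have hscale : spanSingleton (𝓞 K)⁰ (β * c ^ 2) * (𝔞 * ((t : FracIdeal K) * different K ^ 3)⁻¹) =
      (𝔮 : FracIdeal K) ^ 2 * ((𝔡 : FracIdeal K) * (t * different K))⁻¹ := by
    rw [hspan]
    field_simp
  conv_lhs => rw [← mul_div_cancel_left₀ γ he]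
  rw [div_mem_iff_mem_spanSingleton_mul he, hscale, mem_iff_forall_ordGe (by positivity)]
  refine forall_congr' fun v => ?_
  rw [FractionalIdeal.count_mul K v (by positivity) (by positivity), FractionalIdeal.count_pow,
    FractionalIdeal.count_inv, FractionalIdeal.count_mul K v h𝔡' (by positivity),
    FractionalIdeal.count_mul K v ht' hD, Nat.cast_ofNat, sub_sub, sub_sub, ← sub_eq_add_neg]

theorem ordGe_of_mem_mul_inv (h𝔞 : 𝔞 ≠ 0) (h𝔠 : 𝔠 ≠ 0) (h𝔡 : 𝔡 ≠ ⊥) (h𝔮 : 𝔮 ≠ ⊥)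
    (h𝔮₁ : 𝔮₁ ∣ modulus 𝔡 𝔮)
    (hβ : spanSingleton (𝓞 K)⁰ β = (𝔠 * different K) ^ 2 * (𝔞 * (𝔡 : FracIdeal K))⁻¹)
    (hc : spanSingleton (𝓞 K)⁰ c = 𝔠⁻¹ * (𝔮 : FracIdeal K))
    (hγ : γ ∈ 𝔞 * ((modulus 𝔡 𝔮 : FracIdeal K) * (𝔮₁ : FracIdeal K) ^ 2 * different K ^ 3)⁻¹)
    (v : HeightOneSpectrum (𝓞 K)) :
    OrdGe v (2 * count K v 𝔮 - count K v 𝔡 - count K v (modulus 𝔡 𝔮) - 2 * count K v 𝔮₁ -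
      count K v (different K)) (β * c ^ 2 * γ) := by
  have hb := ne_zero_of_dvd_ne_zero h𝔮 (modulus_dvd (𝔡 := 𝔡))
  have h𝔮₁0 := ne_zero_of_dvd_ne_zero hb h𝔮₁
  rw [← FractionalIdeal.coeIdeal_pow, ← FractionalIdeal.coeIdeal_mul, mem_mul_inv_iff_forall_ordGe
    h𝔞 h𝔠 h𝔡 h𝔮 hβ hc (mul_ne_zero hb (pow_ne_zero 2 h𝔮₁0))] at hγ
  have hv := hγ v
  rwa [count_coeIdeal_mul hb (pow_ne_zero 2 h𝔮₁0), FractionalIdeal.coeIdeal_pow,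
    FractionalIdeal.count_pow, Nat.cast_ofNat, ← sub_sub] at hv

theorem ordGe_of_dvd_modulus (h𝔡 : 𝔡 ≠ ⊥) (h𝔮 : 𝔮 ≠ ⊥) {δ : K}
    (hδ : OrdGe v (2 * count K v 𝔮 - count K v 𝔡 - count K v (modulus 𝔡 𝔮) - 2 * count K v 𝔮₁ -
      count K v (different K)) δ) (hv : v.asIdeal ∣ modulus 𝔡 𝔮) :
    OrdGe v (count K v 𝔮 - 2 * count K v 𝔮₁ - count K v (different K)) δ :=
  hδ.mono (by linarith [count_eq_of_dvd_modulus h𝔡 h𝔮 hv])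

theorem mem_mul_inv_iff_forall_dvd (h𝔞 : 𝔞 ≠ 0) (h𝔠 : 𝔠 ≠ 0) (h𝔡 : 𝔡 ≠ ⊥) (h𝔮 : 𝔮 ≠ ⊥)
    (h𝔮₁ : 𝔮₁ ∣ modulus 𝔡 𝔮)
    (hβ : spanSingleton (𝓞 K)⁰ β = (𝔠 * different K) ^ 2 * (𝔞 * (𝔡 : FracIdeal K))⁻¹)
    (hc : spanSingleton (𝓞 K)⁰ c = 𝔠⁻¹ * (𝔮 : FracIdeal K))
    (hγ : γ ∈ 𝔞 * ((modulus 𝔡 𝔮 : FracIdeal K) * (𝔮₁ : FracIdeal K) ^ 2 * different K ^ 3)⁻¹)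
    (hcop : IsCoprime 𝔮₁ (idealDiv 𝔮 𝔮₁)) (ht : t ∣ 𝔮₁) :
    γ ∈ 𝔞 * ((modulus 𝔡 𝔮 * 𝔮₁ * t : Ideal (𝓞 K)) * different K ^ 3)⁻¹ ↔
      ∀ v : HeightOneSpectrum (𝓞 K), v.asIdeal ∣ 𝔮₁ →
        OrdGe v (-(count K v t + count K v (different K))) (β * c ^ 2 * γ) := by
  have hb := ne_zero_of_dvd_ne_zero h𝔮 (modulus_dvd (𝔡 := 𝔡))
  have h𝔮₁𝔮 := h𝔮₁.trans modulus_dvd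
  have h𝔮₁0 := ne_zero_of_dvd_ne_zero hb h𝔮₁
  have ht0 := ne_zero_of_dvd_ne_zero h𝔮₁0 ht
  rw [mem_mul_inv_iff_forall_ordGe h𝔞 h𝔠 h𝔡 h𝔮 hβ hc (mul_ne_zero (mul_ne_zero hb h𝔮₁0) ht0)]
  refine forall_congr' fun v => ?_
  rw [count_coeIdeal_mul (mul_ne_zero hb h𝔮₁0) ht0, count_coeIdeal_mul hb h𝔮₁0]
  by_cases hv : v.asIdeal ∣ 𝔮₁
  · have hcount := count_idealDiv (K := K) v h𝔮 h𝔮₁𝔮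
    rw [count_eq_zero_of_not_dvd (idealDiv_ne_bot h𝔮 h𝔮₁𝔮)
      ((isCoprime_iff_forall_not_dvd h𝔮₁0).1 hcop v hv)] at hcount
    have hexp : 2 * count K v 𝔮 - count K v 𝔡 -
        (count K v (modulus 𝔡 𝔮) + count K v 𝔮₁ + count K v t) - count K v (different K) =
        -(count K v t + count K v (different K)) := by
      linarith [count_eq_of_dvd_modulus h𝔡 h𝔮 (hv.trans h𝔮₁)]
    rw [hexp, forall_prop_of_true hv]
  · refine iff_of_true ?_ fun h => absurd h hv
    have hδ := ordGe_of_mem_mul_inv h𝔞 h𝔠 h𝔡 h𝔮 h𝔮₁ hβ hc hγ v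
    refine hδ.mono ?_
    rw [count_eq_zero_of_not_dvd h𝔮₁0 hv, count_eq_zero_of_not_dvd ht0 fun h => hv (h.trans ht)]
    linarith

theorem exists_expSum_eq (h𝔞 : 𝔞 ≠ 0) (h𝔠 : 𝔠 ≠ 0) (h𝔡 : 𝔡 ≠ ⊥) (h𝔮 : 𝔮 ≠ ⊥)
    (h𝔮₁ : 𝔮₁ ∣ modulus 𝔡 𝔮)
    (hβ : spanSingleton (𝓞 K)⁰ β = (𝔠 * different K) ^ 2 * (𝔞 * (𝔡 : FracIdeal K))⁻¹)
    (hc : spanSingleton (𝓞 K)⁰ c = 𝔠⁻¹ * (𝔮 : FracIdeal K))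
    (hδ : ∀ v : HeightOneSpectrum (𝓞 K), v.asIdeal ∣ modulus 𝔡 𝔮 →
      OrdGe v (count K v 𝔮 - 2 * count K v 𝔮₁ - count K v (different K)) (β * c ^ 2 * γ)) :
    ∃ w : DualQuotient K → 𝓞 K,
      (∀ X ∈ primitiveFinset 𝔮₁, w X ∈ idealDiv 𝔮 𝔮₁ ∧ ∃ x : K, Submodule.Quotient.mk x = X ∧
        ∀ v : HeightOneSpectrum (𝓞 K), v.asIdeal ∣ modulus 𝔡 𝔮 →
          OrdGe v (count K v 𝔮 - count K v 𝔮₁ - count K v (different K))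
            (algebraMap (𝓞 K) K (w X) * x - β * c ^ 2 * γ)) ∧
      expSum 𝔞 𝔠 𝔡 β c γ 𝔮 𝔮₁ =
        ∑ X ∈ primitiveFinset 𝔮₁, quotChar K X * ramanujanSum 𝔮 (1 + w X) := by
  have hD := different_ne_zero (K := K)
  have h𝔡' : (𝔡 : FracIdeal K) ≠ 0 := FractionalIdeal.coeIdeal_ne_zero.2 h𝔡
  have h𝔮' : (𝔮 : FracIdeal K) ≠ 0 := FractionalIdeal.coeIdeal_ne_zero.2 h𝔮
  have hspan : spanSingleton (𝓞 K)⁰ (β * c) =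
      (𝔞 * (𝔡 : FracIdeal K) * (𝔠 * different K)⁻¹)⁻¹ * 𝔮 * different K := by
    rw [← FractionalIdeal.spanSingleton_mul_spanSingleton, hβ, hc]
    field_simp
  have hβc : β * c ≠ 0 := by
    rw [← FractionalIdeal.spanSingleton_ne_zero_iff (S := (𝓞 K)⁰), hspan]
    positivity
  have hbij := bijOn_mk_rep_invClass_div (by positivity) h𝔮 hspan
  obtain ⟨w, hw, hkl⟩ := exists_kloosterman_eq
    (ne_zero_of_dvd_ne_zero h𝔮 modulus_dvd) h𝔮 modulus_dvd h𝔮₁ hδ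
  refine ⟨w, hw, ?_⟩
  rw [expSum, finsum_mem_eq_of_bijOn _ hbij (g := fun Y => ∑ X ∈ primitiveFinset 𝔮₁,
    quotChar K X * quotChar K (-(1 + w X) • Y)), finsum_mem_coe_finset, Finset.sum_comm]
  · refine Finset.sum_congr rfl fun X _ => ?_
    rw [← Finset.mul_sum, ← ramanujanSum_neg h𝔮, ramanujanSum]
  · intro X hX
    have hY := (mk_mem_dualTorsion_iff h𝔮).1 <|
      mem_torsionBySet_iff_torsionOf_dvd.2 ((mem_primitiveFinset h𝔮).1 (hbij.mapsTo hX)).dvd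
    set y := rep (invClass X)
    have harg : -γ * c * y = -(β * c ^ 2 * γ * (y / (β * c))) := by
      have := left_ne_zero_of_mul hβc
      have := right_ne_zero_of_mul hβc
      field_simp
    rw [harg, hkl _ hY, psiInf_mixedEmbedding_eq_traceChar, Finset.mul_sum]
    refine Finset.sum_congr rfl fun X' _ => ?_
    rw [neg_smul, add_smul, one_smul, neg_add, AddChar.map_add_eq_mul, ← Submodule.Quotient.mk_neg,
      quotChar_mk, mul_left_comm]

end ExponentialSum

section Evaluation

open FractionalIdeal (count spanSingleton)

variable {K : Type*} [Field K] [NumberField K]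

theorem idealMoebius_mul_idealMoebius_eq_zero {a k f : Ideal (𝓞 K)} (ha : a ≠ ⊥) (hk : k ∣ a)
    (hf : f ∣ a) (hkf : IsCoprime k f) (h : ¬ f ∣ squarefreePart a) :
    idealMoebius (idealDiv a k) * idealMoebius f = 0 := by
  by_cases hs : Squarefree f
  · obtain ⟨v, hvf, hva⟩ : ∃ v : HeightOneSpectrum (𝓞 K), v.asIdeal ∣ f ∧ v.asIdeal ^ 2 ∣ a := by
      by_contra! hv
      exact h (dvd_squarefreePart ha hs fun v hvf => ⟨hvf.trans hf, hv v hvf⟩)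
    have hvk : ¬ v.asIdeal ∣ k := fun hvk =>
      (isCoprime_iff_forall_not_dvd (ne_zero_of_dvd_ne_zero ha hk)).1 hkf v hvk hvf
    have hsq : v.asIdeal ^ 2 ∣ idealDiv a k :=
      (isCoprime_of_prime_of_not_dvd v.prime hvk).pow_left.dvd_of_dvd_mul_left
        ((idealDiv_mul_cancel hk).symm ▸ hva)
    rw [idealMoebius_eq_zero_of_sq_dvd v.prime hsq, zero_mul]
  · rw [idealMoebius_of_not_squarefree hs, mul_zero]

open scoped Classical in
theorem sum_idealMoebius_mul_eq_finsum {a : Ideal (𝓞 K)} (ha : a ≠ ⊥)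
    (P : Ideal (𝓞 K) × Ideal (𝓞 K) → Prop) (g : Ideal (𝓞 K) → ℂ) :
    ∑ p ∈ idealDivisors a ×ˢ idealDivisors a with IsCoprime p.1 p.2 ∧ P p,
        (idealMoebius (idealDiv a p.1) : ℂ) * idealMoebius p.2 / Ideal.absNorm p.2 * g p.2 =
      ∑ᶠ p ∈ {p : Ideal (𝓞 K) × Ideal (𝓞 K) |
          p.1 ∣ a ∧ p.2 ∣ squarefreePart a ∧ IsCoprime p.1 p.2 ∧ P p},
        (idealMoebius (idealDiv a p.1) : ℂ) * idealMoebius p.2 / Ideal.absNorm p.2 * g p.2 := by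
  refine (finsum_mem_eq_sum_of_inter_support_eq _ (Set.ext fun p => ?_)).symm
  simp only [Set.mem_inter_iff, Set.mem_ofPred_eq, Finset.mem_coe, Function.mem_support,
    Finset.mem_filter, Finset.mem_product, mem_idealDivisors ha]
  refine and_congr_left fun hp => ⟨fun ⟨hk, hf, h⟩ => ⟨⟨hk, hf.trans (squarefreePart_dvd ha)⟩, h⟩,
    fun ⟨⟨hk, hf⟩, h⟩ => ⟨hk, ?_, h⟩⟩
  contrapose! hp
  rw [← Int.cast_mul, idealMoebius_mul_idealMoebius_eq_zero ha hk hf h.1 hp, Int.cast_zero,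
    zero_div, zero_mul]

variable {𝔞 𝔠 : FracIdeal K} {𝔡 𝔮 𝔮₁ : Ideal (𝓞 K)} {β c γ : K}

theorem expSum_eq_zero (h𝔞 : 𝔞 ≠ 0) (h𝔠 : 𝔠 ≠ 0) (h𝔡 : 𝔡 ≠ ⊥) (h𝔮 : 𝔮 ≠ ⊥)
    (h𝔮₁ : 𝔮₁ ∣ modulus 𝔡 𝔮)
    (hβ : spanSingleton (𝓞 K)⁰ β = (𝔠 * different K) ^ 2 * (𝔞 * (𝔡 : FracIdeal K))⁻¹)
    (hc : spanSingleton (𝓞 K)⁰ c = 𝔠⁻¹ * (𝔮 : FracIdeal K))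
    (hδ : ∀ v : HeightOneSpectrum (𝓞 K), v.asIdeal ∣ modulus 𝔡 𝔮 →
      OrdGe v (count K v 𝔮 - 2 * count K v 𝔮₁ - count K v (different K)) (β * c ^ 2 * γ))
    (hcop : ¬ IsCoprime 𝔮₁ (idealDiv 𝔮 𝔮₁)) : expSum 𝔞 𝔠 𝔡 β c γ 𝔮 𝔮₁ = 0 := by
  obtain ⟨w, hw, hsum⟩ := exists_expSum_eq h𝔞 h𝔠 h𝔡 h𝔮 h𝔮₁ hβ hc hδ
  rw [hsum]
  refine Finset.sum_eq_zero fun X hX => ?_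
  rw [ramanujanSum_one_add_eq_zero h𝔮 (h𝔮₁.trans modulus_dvd) hcop (hw X hX).1, mul_zero]

open scoped Classical in
theorem expSum_eq_of_isCoprime (h𝔞 : 𝔞 ≠ 0) (h𝔠 : 𝔠 ≠ 0) (h𝔡 : 𝔡 ≠ ⊥) (h𝔮 : 𝔮 ≠ ⊥)
    (h𝔮₁ : 𝔮₁ ∣ modulus 𝔡 𝔮)
    (hβ : spanSingleton (𝓞 K)⁰ β = (𝔠 * different K) ^ 2 * (𝔞 * (𝔡 : FracIdeal K))⁻¹)
    (hc : spanSingleton (𝓞 K)⁰ c = 𝔠⁻¹ * (𝔮 : FracIdeal K))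
    (hδ : ∀ v : HeightOneSpectrum (𝓞 K), v.asIdeal ∣ modulus 𝔡 𝔮 →
      OrdGe v (count K v 𝔮 - 2 * count K v 𝔮₁ - count K v (different K)) (β * c ^ 2 * γ))
    (hcop : IsCoprime 𝔮₁ (idealDiv 𝔮 𝔮₁)) :
    expSum 𝔞 𝔠 𝔡 β c γ 𝔮 𝔮₁ =
      psiIdeal (modulus 𝔡 𝔮) (-(β * c ^ 2 * γ)) * idealMoebius (idealDiv 𝔮 𝔮₁) *
        Ideal.absNorm 𝔮₁ *
        ∑ p ∈ idealDivisors 𝔮₁ ×ˢ idealDivisors 𝔮₁ with IsCoprime p.1 p.2 ∧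
          ∀ v : HeightOneSpectrum (𝓞 K), v.asIdeal ∣ 𝔮₁ →
            OrdGe v (-(count K v (p.1 * p.2 : Ideal (𝓞 K)) + count K v (different K)))
              (β * c ^ 2 * γ),
        (idealMoebius (idealDiv 𝔮₁ p.1) : ℂ) * idealMoebius p.2 / Ideal.absNorm p.2 *
          psiIdeal p.2 (β * c ^ 2 * γ) := by
  have h𝔮₁𝔮 := h𝔮₁.trans modulus_dvd
  have h𝔮₁0 := ne_zero_of_dvd_ne_zero h𝔮 h𝔮₁𝔮
  have hψ : psiIdeal (modulus 𝔡 𝔮) (-(β * c ^ 2 * γ)) = psiIdeal 𝔮₁ (-(β * c ^ 2 * γ)) :=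
    psiIdeal_eq_of_dvd h𝔮₁ fun v hv hv₁ => ordGe_neg_iff.2 <| (hδ v hv).mono <| by
      linarith [count_eq_zero_of_not_dvd (K := K) h𝔮₁0 hv₁,
        FractionalIdeal.count_coe_nonneg K v 𝔮]
  obtain ⟨w, hw, hsum⟩ := exists_expSum_eq h𝔞 h𝔠 h𝔡 h𝔮 h𝔮₁ hβ hc hδ
  obtain ⟨d, hd⟩ := exists_isLocalPart 𝔮₁ (β * c ^ 2 * γ)
  have hwX : ∀ X ∈ primitiveFinset 𝔮₁, w X • X = Submodule.Quotient.mk d := fun X hX => by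
    obtain ⟨-, x, rfl, hx⟩ := hw X hX
    have hX' := mem_torsionBySet_iff_torsionOf_dvd.2 ((mem_primitiveFinset h𝔮₁0).1 hX).dvd
    exact hd.smul_mk_eq h𝔮₁0 hX' fun v hv => (hx v (hv.trans h𝔮₁)).mono <| by
      linarith [count_le_of_dvd (K := K) (v := v) h𝔮 h𝔮₁𝔮]
  calc expSum 𝔞 𝔠 𝔡 β c γ 𝔮 𝔮₁
      = idealMoebius (idealDiv 𝔮 𝔮₁) *
          ∑ X ∈ primitiveFinset 𝔮₁, quotChar K X * ramanujanSum 𝔮₁ (1 + w X) := by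
        rw [hsum, Finset.mul_sum]
        refine Finset.sum_congr rfl fun X hX => ?_
        rw [ramanujanSum_one_add_eq h𝔮 h𝔮₁𝔮 hcop (hw X hX).1]
        ring
    _ = _ := by
        rw [hd.sum_quotChar_mul_ramanujanSum h𝔮₁0 hwX, hψ]
        ring

end Evaluation

end VoronoiSum

end

theorem mainTheorem12 {K : Type*} [Field K] [NumberField K]
    (𝔞 𝔠 : VoronoiSum.FracIdeal K) (h𝔞 : 𝔞 ≠ 0) (h𝔠 : 𝔠 ≠ 0)
    (𝔡 𝔮 𝔮₁ : Ideal (𝓞 K)) (h𝔡 : 𝔡 ≠ ⊥) (h𝔮 : 𝔮 ≠ ⊥)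
    (h𝔮₁ : 𝔮₁ ∣ VoronoiSum.modulus 𝔡 𝔮)
    (β c γ : K)
    (hβ : FractionalIdeal.spanSingleton (𝓞 K)⁰ β =
      (𝔠 * VoronoiSum.different K) ^ 2 * (𝔞 * (𝔡 : VoronoiSum.FracIdeal K))⁻¹)
    (hc : FractionalIdeal.spanSingleton (𝓞 K)⁰ c = 𝔠⁻¹ * (𝔮 : VoronoiSum.FracIdeal K))
    (hγ : γ ∈ 𝔞 * ((VoronoiSum.modulus 𝔡 𝔮 : VoronoiSum.FracIdeal K) *
      (𝔮₁ : VoronoiSum.FracIdeal K) ^ 2 * VoronoiSum.different K ^ 3)⁻¹) :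
    (¬ IsCoprime 𝔮₁ (VoronoiSum.idealDiv 𝔮 𝔮₁) →
      VoronoiSum.expSum 𝔞 𝔠 𝔡 β c γ 𝔮 𝔮₁ = 0) ∧
    (IsCoprime 𝔮₁ (VoronoiSum.idealDiv 𝔮 𝔮₁) →
      VoronoiSum.expSum 𝔞 𝔠 𝔡 β c γ 𝔮 𝔮₁ =
        VoronoiSum.psiIdeal (VoronoiSum.modulus 𝔡 𝔮) (-(β * c ^ 2 * γ)) *
          (VoronoiSum.idealMoebius (VoronoiSum.idealDiv 𝔮 𝔮₁) : ℂ) *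
          (Ideal.absNorm 𝔮₁ : ℂ) *
          ∑ᶠ p ∈ {p : Ideal (𝓞 K) × Ideal (𝓞 K) |
              p.1 ∣ 𝔮₁ ∧ p.2 ∣ VoronoiSum.squarefreePart 𝔮₁ ∧
              IsCoprime p.1 (VoronoiSum.idealDiv 𝔮 𝔮₁) ∧ IsCoprime p.1 p.2 ∧
              γ ∈ 𝔞 * ((VoronoiSum.modulus 𝔡 𝔮 : VoronoiSum.FracIdeal K) *
                (𝔮₁ : VoronoiSum.FracIdeal K) * (p.1 : VoronoiSum.FracIdeal K) *
                (p.2 : VoronoiSum.FracIdeal K) * VoronoiSum.different K ^ 3)⁻¹},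
            (VoronoiSum.idealMoebius (VoronoiSum.idealDiv 𝔮₁ p.1) : ℂ) *
              (VoronoiSum.idealMoebius p.2 : ℂ) / (Ideal.absNorm p.2 : ℂ) *
              VoronoiSum.psiIdeal p.2 (β * c ^ 2 * γ)) := by
  open VoronoiSum in
  have hδ := fun v hv => ordGe_of_dvd_modulus h𝔡 h𝔮
    (ordGe_of_mem_mul_inv h𝔞 h𝔠 h𝔡 h𝔮 h𝔮₁ hβ hc hγ v) hv
  have h𝔮₁0 := ne_zero_of_dvd_ne_zero h𝔮 (h𝔮₁.trans modulus_dvd)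
  refine ⟨expSum_eq_zero h𝔞 h𝔠 h𝔡 h𝔮 h𝔮₁ hβ hc hδ, fun hcop => ?_⟩
  rw [expSum_eq_of_isCoprime h𝔞 h𝔠 h𝔡 h𝔮 h𝔮₁ hβ hc hδ hcop,
    sum_idealMoebius_mul_eq_finsum h𝔮₁0 _ fun f => psiIdeal f (β * c ^ 2 * γ)]
  congr 1
  refine finsum_mem_congr (Set.ext fun p => ?_) fun _ _ => rfl
  refine and_congr_right fun hk => and_congr_right fun hf => ?_
  rw [and_iff_right (hcop.of_isCoprime_of_dvd_left hk)]
  refine and_congr_right fun hkf => ?_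
  rw [← mem_mul_inv_iff_forall_dvd h𝔞 h𝔠 h𝔡 h𝔮 h𝔮₁ hβ hc hγ hcop
    (hkf.mul_dvd hk (hf.trans (squarefreePart_dvd h𝔮₁0)))]
  simp only [FractionalIdeal.coeIdeal_mul, mul_assoc]
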